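/- Let $\lambda_1,\dots,\lambda_8$ be the Gell-Mann matrices and $X_a=\frac{i}{2\sqrt3}\lambda_a\in\mathfrak{su}(3)$; this frame is orthonormal for the Killing inner product $k$ (the opposite of the Killing form). For nonzero real $\alpha,\beta,\gamma$ let $h$ be the left-invariant, right-$U(2)$-invariant pseudo-Riemannian metric on $SU(3)$ with $$h^{-1}=\alpha\sum_{a=1}^{3}X_a\otimes X_a+\beta\sum_{a=4}^{7}X_a\otimes X_a+\gamma\,X_8\otimes X_8,$$ where $U(2)\cong S(U(2)\times U(1))\subset SU(3)$ is the block-diagonal subgroup, with Lie algebra spanned by $i\lambda_1,i\lambda_2,i\lambda_3,i\lambda_8$. Let $\Delta$ be the Laplacian of $h$ on functions, $\Delta f=h^{ab}\big(X_aX_bf-(\nabla_{X_a}X_b)f\big)$ with $\nabla$ the Levi-Civita connection and the $X_a$ acting as left-invariant vector fields; in a representation of $SU(3)$, $-\Delta$ is evaluated as the modified Casimir element $-h^{ab}X_aX_b$. Let $\pi$ be a finite-dimensional continuous complex irreducible representation of $SU(3)$ on $V$, with highest weight $w=(o_1,o_2)$ in Dynkin labels, and write $\dim(w)=\dim V$.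 Let $L_a$ be the operators by which $\lambda_a$ acts on $V$ (so $d\pi(i\lambda_a)=iL_a$). A $U(2)$-irreducible subspace of $V$ has isospin $I\in\frac12\mathbb N$ and hypercharge $Y\in\frac13\mathbb Z$ if it has a nonzero vector killed by $L_1+iL_2$ on which $L_3=2I$ and $\frac1{\sqrt3}L_8=Y$; let $V_{I,Y}$ be the sum of all such subspaces. For a subspace $W\subseteq V$ let $M(W)$ be the span of the functions $g\mapsto\varphi(\pi(g)v)$ on $SU(3)$, with $\varphi\in V^*$ and $v\in W$. Put $$C_2(o_1,o_2)=\tfrac16\Big(\tfrac23(o_1^2+o_1o_2+o_2^2)+2(o_1+o_2)\Big),$$ $$C(o_1,o_2;I,Y)=\beta\,C_2(o_1,o_2)+\tfrac13(\alpha-\beta)\,I(I+1)+\tfrac14(\gamma-\beta)\,Y^2 .$$ Then: 1. The Casimir element $-\sum_aX_aX_a$ of the Killing form acts on $V$ as the scalar $C_2(o_1,o_2)$. 2. $V$ is the direct sum of the $V_{I,Y}$, of which finitely many are nonzero, and each nonzero $V_{I,Y}$ is $U(2)$-irreducible of isospin $I$ and hypercharge $Y$, of dimension $2I+1$. 3.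 If $V_{I,Y}\neq0$, then $-\Delta$ evaluated in $V$ acts on $V_{I,Y}$ as the scalar $C(o_1,o_2;I,Y)$. Every $f\in M(V_{I,Y})$ is smooth and satisfies $-\Delta f=C(o_1,o_2;I,Y)\,f$, and the multiplicity of this eigenvalue coming from $(w,I,Y)$ is $\dim M(V_{I,Y})=\dim(w)\,(2I+1)$. 4. For every $x\in\mathbb C$, the multiplicity of $x$ as an eigenvalue of $-\Delta$ on $M(V)$ is the sum of $\dim(w)\,(2I+1)$ over all $(I,Y)$ with $V_{I,Y}\neq0$ and $C(o_1,o_2;I,Y)=x$. -/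

import Mathlib

open scoped Matrix ContDiff

noncomputable section

/-! ### The group `SU(3)`, its Lie algebra and the exponential map -/

/-- The group `SU(3)`. -/
abbrev SU3 : Type := Matrix.specialUnitaryGroup (Fin 3) ℂ

section

attribute [local instance 100] LieRing.ofAssociativeRing

/-- The real Lie algebra `su(3)` of traceless anti-Hermitian `3 × 3` matrices. -/
def su3 : LieSubalgebra ℝ (Matrix (Fin 3) (Fin 3) ℂ) where
  carrier := {x | xᴴ = -x ∧ x.trace = 0}
  zero_mem' := by simp
  add_mem' := by
    rintro x y ⟨hx, hx'⟩ ⟨hy, hy'⟩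
    refine ⟨?_, ?_⟩
    · rw [Matrix.conjTranspose_add, hx, hy]; abel
    · rw [Matrix.trace_add, hx', hy', add_zero]
  smul_mem' := by
    rintro c x ⟨hx, hx'⟩
    refine ⟨?_, ?_⟩
    · rw [Matrix.conjTranspose_smul, hx]; simp
    · rw [Matrix.trace_smul, hx', smul_zero]
  lie_mem' := by
    rintro x y ⟨hx, _⟩ ⟨hy, _⟩
    refine ⟨?_, ?_⟩
    · rw [Ring.lie_def, Matrix.conjTranspose_sub, Matrix.conjTranspose_mul,
        Matrix.conjTranspose_mul, hx, hy]
      simp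
    · rw [Ring.lie_def, Matrix.trace_sub, Matrix.trace_mul_comm, sub_self]

end

/-- The determinant of the exponential of a traceless anti-Hermitian matrix is `1`. -/
theorem det_exp_su3 (x : Matrix (Fin 3) (Fin 3) ℂ) (hx : xᴴ = -x) (ht : x.trace = 0) :
    (NormedSpace.exp x).det = 1 := by
  have hH : ((-Complex.I) • x).IsHermitian := by
    unfold Matrix.IsHermitian
    rw [Matrix.conjTranspose_smul, hx]
    simp
  set U : Matrix (Fin 3) (Fin 3) ℂ := (hH.eigenvectorUnitary : Matrix (Fin 3) (Fin 3) ℂ) with hU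
  have hU1 : U * star U = 1 := Unitary.coe_mul_star_self hH.eigenvectorUnitary
  have hU2 : U⁻¹ = star U := Matrix.inv_eq_right_inv hU1
  have hUu : IsUnit U := IsUnit.of_mul_eq_one _ hU1
  have hdet : U.det * U⁻¹.det = 1 := by rw [hU2, ← Matrix.det_mul, hU1, Matrix.det_one]
  have key : x = U * Matrix.diagonal (fun i => Complex.I * (hH.eigenvalues i : ℂ)) * U⁻¹ := by
    have h := hH.spectral_theorem
    rw [Unitary.conjStarAlgAut_apply] at h
    have h2 : x = Complex.I • ((-Complex.I) • x) := by
      rw [smul_smul]; simp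
    have h3 : Matrix.diagonal (fun i => Complex.I * (hH.eigenvalues i : ℂ))
        = Complex.I • Matrix.diagonal (RCLike.ofReal ∘ hH.eigenvalues : Fin 3 → ℂ) := by
      rw [← Matrix.diagonal_smul]; rfl
    rw [h3, Matrix.mul_smul, Matrix.smul_mul, hU2]
    exact h2.trans (congrArg (fun M => Complex.I • M) h)
  rw [key, Matrix.exp_conj _ _ hUu, Matrix.det_mul, Matrix.det_mul, Matrix.exp_diagonal,
    Matrix.det_diagonal]
  have hsum : ∑ i, Complex.I * (hH.eigenvalues i : ℂ) = 0 := by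
    have h := hH.trace_eq_sum_eigenvalues
    rw [Matrix.trace_smul, ht, smul_zero] at h
    rw [← Finset.mul_sum]
    have h' : ∑ i, (hH.eigenvalues i : ℂ) = 0 := h.symm
    rw [h', mul_zero]
  have hprod : ∏ i, NormedSpace.exp (fun i => Complex.I * (hH.eigenvalues i : ℂ)) i = 1 := by
    simp only [Pi.coe_exp, ← Complex.exp_eq_exp_ℂ]
    rw [← Complex.exp_sum, hsum, Complex.exp_zero]
  rw [hprod, mul_one, hdet]

/-- The exponential map `su(3) → SU(3)`. -/
def expSU3 (x : su3) : SU3 :=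
  ⟨NormedSpace.exp (x : Matrix (Fin 3) (Fin 3) ℂ), by
    have hx : (x : Matrix (Fin 3) (Fin 3) ℂ)ᴴ = -(x : Matrix (Fin 3) (Fin 3) ℂ) := x.2.1
    refine Matrix.mem_specialUnitaryGroup_iff.2 ⟨?_, det_exp_su3 _ x.2.1 x.2.2⟩
    rw [Matrix.mem_unitaryGroup_iff, Matrix.star_eq_conjTranspose, ← Matrix.exp_conjTranspose, hx,
      ← Matrix.exp_add_of_commute _ _ (Commute.refl (x : Matrix (Fin 3) (Fin 3) ℂ)).neg_right,
      add_neg_cancel,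
      NormedSpace.exp_zero]⟩

/-- The subgroup `S(U(2) × U(1)) ≅ U(2)` of block-diagonal matrices in `SU(3)`; its Lie algebra is
spanned by `i λ₁, i λ₂, i λ₃, i λ₈`. -/
def U2 : Subgroup SU3 where
  carrier := {g | g.1 0 2 = 0 ∧ g.1 1 2 = 0 ∧ g.1 2 0 = 0 ∧ g.1 2 1 = 0}
  one_mem' := by simp
  mul_mem' := by
    rintro a b ⟨h1, h2, h3, h4⟩ ⟨k1, k2, k3, k4⟩
    simp [Matrix.mul_apply, Fin.sum_univ_three, h1, h2, h3, h4, k1, k2, k3, k4]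
  inv_mem' := by
    rintro a ⟨h1, h2, h3, h4⟩
    have h : (a⁻¹).1 = star a.1 := rfl
    simp only [Set.mem_ofPred_eq, h, Matrix.star_apply, h1, h2, h3, h4, star_zero, and_self]

/-! ### The Gell-Mann basis -/

/-- The Gell-Mann matrices `λ₁, …, λ₈` (the index `a : Fin 8` stands for `λ_{a+1}`). -/
def gellMann : Fin 8 → Matrix (Fin 3) (Fin 3) ℂ :=
  ![!![0, 1, 0; 1, 0, 0; 0, 0, 0],
    !![0, -Complex.I, 0; Complex.I, 0, 0; 0, 0, 0],
    !![1, 0, 0; 0, -1, 0; 0, 0, 0],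
    !![0, 0, 1; 0, 0, 0; 1, 0, 0],
    !![0, 0, -Complex.I; 0, 0, 0; Complex.I, 0, 0],
    !![0, 0, 0; 0, 0, 1; 0, 1, 0],
    !![0, 0, 0; 0, 0, -Complex.I; 0, Complex.I, 0],
    ((1 / Real.sqrt 3 : ℝ) : ℂ) • !![1, 0, 0; 0, 1, 0; 0, 0, -2]]

/-- The element `i λ_{a+1}` of `su(3)`. -/
def iGellMann (a : Fin 8) : su3 :=
  ⟨Complex.I • gellMann a, by
    constructor
    · fin_cases a <;> ext i j <;> fin_cases i <;> fin_cases j <;>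
        simp [gellMann, Matrix.conjTranspose_apply]
    · fin_cases a <;> simp [gellMann, Matrix.trace, Fin.sum_univ_three]
      ring⟩

/-- The frame `X_a = i λ_a / (2√3)`, orthonormal for the Killing inner product. -/
def frame (a : Fin 8) : su3 := (1 / (2 * Real.sqrt 3) : ℝ) • iGellMann a

/-! ### Left-invariant metrics and their Laplacians

A left-invariant (pseudo-)Riemannian metric is given by its value at the identity, a nondegenerate
symmetric bilinear form on `su(3)`. -/

/-- The Killing inner product: the opposite of the Killing form. -/
def killingInner : LinearMap.BilinForm ℝ su3 := -killingForm ℝ su3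

/-- The components `(α, α, α, β, β, β, β, γ)` of the dual metric in the frame `X_a`. -/
def dualComponents (α β γ : ℝ) : Fin 8 → ℝ := ![α, α, α, β, β, β, β, γ]

/-- The left-invariant, right-`U(2)`-invariant metric with parameters `α, β, γ`:
`h = ∑ₐ dₐ⁻¹ θᵃ ⊗ θᵃ` with `θᵃ = k(X_a, ·)` the coframe dual to the `k`-orthonormal frame `X_a`
and `d = (α, α, α, β, β, β, β, γ)`, so that `h⁻¹ = ∑ₐ dₐ X_a ⊗ X_a`. -/
def u2Metric (α β γ : ℝ) : LinearMap.BilinForm ℝ su3 :=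
  ∑ a, (dualComponents α β γ a)⁻¹ •
    (killingInner (frame a)).smulRight (killingInner (frame a))

/-- The components `h^{ab}` of the dual metric in the frame `X_a`. -/
def dualMetric (h : LinearMap.BilinForm ℝ su3) : Matrix (Fin 8) (Fin 8) ℝ :=
  (Matrix.of fun a b => h (frame a) (frame b))⁻¹

/-- The Christoffel symbols of the Levi-Civita connection in the left-invariant frame,
`∇_{X_a} X_b = ∑_c Γ_{ab}^c X_c`, given by the Koszul formula. -/
def christoffel (h : LinearMap.BilinForm ℝ su3) (a b c : Fin 8) : ℝ :=
  ∑ d, dualMetric h c d *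
    ((h ⁅frame a, frame b⁆ (frame d) - h ⁅frame b, frame d⁆ (frame a)
      + h ⁅frame d, frame a⁆ (frame b)) / 2)

/-- The left-invariant vector field `x ∈ su(3)` acting on functions on `SU(3)`. -/
def leftField (x : su3) (f : SU3 → ℂ) (g : SU3) : ℂ :=
  deriv (fun t : ℝ => f (g * expSU3 (t • x))) 0

/-- The metric Laplacian (trace of the covariant Hessian) of the left-invariant metric `h`:
`Δ f = ∑ h^{ab} (X_a X_b f - (∇_{X_a} X_b) f)`. -/
def laplacian (h : LinearMap.BilinForm ℝ su3) (f : SU3 → ℂ) (g : SU3) : ℂ :=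
  ∑ a, ∑ b, (dualMetric h a b : ℂ) *
    (leftField (frame a) (leftField (frame b) f) g
      - ∑ c, (christoffel h a b c : ℂ) * leftField (frame c) f g)

/-- Smooth functions on `SU(3)`: smooth in the exponential coordinates centred at every point. -/
def IsSmooth (f : SU3 → ℂ) : Prop :=
  ∀ g : SU3, ContDiff ℝ ∞ (fun c : Fin 8 → ℝ => f (g * expSU3 (∑ a, c a • frame a)))

/-! ### Representations -/

section Representations

variable {V : Type*} [NormedAddCommGroup V] [NormedSpace ℂ V]

/-- The infinitesimal action of `su(3)` on a representation of `SU(3)`. -/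
def dRep (π : Representation ℂ SU3 V) (x : su3) (v : V) : V :=
  deriv (fun t : ℝ => π (expSU3 (t • x)) v) 0

/-- The Hermitian generator `L_{a+1}`, defined by `i L_a = dπ(i λ_a)`. -/
def opL (π : Representation ℂ SU3 V) (a : Fin 8) (v : V) : V :=
  (-Complex.I) • dRep π (iGellMann a) v

/-- `π` is irreducible with highest weight of Dynkin labels `(o₁, o₂)`: there is a nonzero vector
annihilated by the raising operators `(L₁ + i L₂)/2` and `(L₆ + i L₇)/2` of the simple roots, on
which the coroots `L₃` and `(-L₃ + √3 L₈)/2` act by `o₁` and `o₂`. -/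
def IsIrrepOfHighestWeight (π : Representation ℂ SU3 V) (o₁ o₂ : ℕ) : Prop :=
  π.IsIrreducible ∧ ∃ v : V, v ≠ 0 ∧
    opL π 0 v + Complex.I • opL π 1 v = 0 ∧
    opL π 5 v + Complex.I • opL π 6 v = 0 ∧
    opL π 2 v = (o₁ : ℂ) • v ∧
    (1 / 2 : ℂ) • (-opL π 2 v + ((Real.sqrt 3 : ℝ) : ℂ) • opL π 7 v) = (o₂ : ℂ) • v

/-- `W` is an irreducible `U(2)`-subrepresentation of `V` with isospin `I = n / 2` and hypercharge
`Y = m / 3`: it has a vector annihilated by `(L₁ + i L₂)/2` on which `L₃ = 2 I` and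
`√3 L₈ = 3 Y`. -/
structure IsU2Irrep (π : Representation ℂ SU3 V) (n : ℕ) (m : ℤ) (W : Submodule ℂ V) : Prop where
  invariant : ∀ g ∈ U2, ∀ w ∈ W, π g w ∈ W
  ne_bot : W ≠ ⊥
  minimal : ∀ W' ≤ W, (∀ g ∈ U2, ∀ w ∈ W', π g w ∈ W') → W' = ⊥ ∨ W' = W
  weight : ∃ w ∈ W, w ≠ 0 ∧
    opL π 0 w + Complex.I • opL π 1 w = 0 ∧
    opL π 2 w = (n : ℂ) • w ∧
    ((Real.sqrt 3 : ℝ) : ℂ) • opL π 7 w = (m : ℂ) • w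

/-- The pairs `(2I, 3Y)` that occur in the branching of `π` from `SU(3)` to `U(2)`. -/
def branching (π : Representation ℂ SU3 V) : Set (ℕ × ℤ) :=
  {p | ∃ W : Submodule ℂ V, IsU2Irrep π p.1 p.2 W}

/-- The `U(2)`-isotypic component of `V` with `(2I, 3Y) = (n, m)`: the sum of all irreducible
`U(2)`-subrepresentations of that type. -/
def u2Component (π : Representation ℂ SU3 V) (n : ℕ) (m : ℤ) : Submodule ℂ V :=
  sSup {W | IsU2Irrep π n m W}

/-- The Casimir element `Ω₂ = -∑ X_a X_a` of the Killing form, evaluated in `π`. -/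
def casimir (π : Representation ℂ SU3 V) (v : V) : V :=
  -∑ a, dRep π (frame a) (dRep π (frame a) v)

/-- The modified Casimir element `-∑ h^{ab} X_a X_b` of the metric `h`, evaluated in `π`. -/
def modifiedCasimir (h : LinearMap.BilinForm ℝ su3) (π : Representation ℂ SU3 V) (v : V) : V :=
  -∑ a, ∑ b, (dualMetric h a b : ℂ) • dRep π (frame a) (dRep π (frame b) v)

/-- The space of matrix coefficients `g ↦ φ(π(g) w)` with `φ ∈ V*` and `w ∈ W`. -/
def matrixCoeff (π : Representation ℂ SU3 V) (W : Submodule ℂ V) : Submodule ℂ (SU3 → ℂ) :=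
  Submodule.span ℂ {f | ∃ (φ : Module.Dual ℂ V) (w : V), w ∈ W ∧ f = fun g => φ (π g w)}

end Representations

/-! ### The eigenvalues -/

/-- The eigenvalue of the Casimir element of the Killing form in the irrep `(o₁, o₂)`. -/
def casimirC2 (o₁ o₂ : ℝ) : ℝ :=
  (2 / 3 * (o₁ ^ 2 + o₁ * o₂ + o₂ ^ 2) + 2 * (o₁ + o₂)) / 6

/-- `β C₂(o₁, o₂) + (α - β) I (I + 1) / 3 + (γ - β) Y² / 4`. -/
def laplaceEigenvalue (α β γ o₁ o₂ I Y : ℝ) : ℝ :=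
  β * casimirC2 o₁ o₂ + (α - β) * (I * (I + 1)) / 3 + (γ - β) * Y ^ 2 / 4

end

/-! On the function g ↦ tr(π(g) T) a left-invariant field x acts by T ↦ dπ(x) T. On matrix
coefficients the Laplacian is therefore left multiplication of T by an operator on V
(`laplacian_traceCoeff`). No connection terms survive: h is diagonal in a frame orthonormal for the
Killing product, whose invariance kills the diagonal Christoffel symbols (`christoffel_self`). By
Burnside's theorem T ↦ tr(π(·) T) is injective, so eigenfunctions correspond to linear maps from V
into an eigenspace W of that operator, and these form a space of dimension dim V · dim W
(`eigenfunction_iff`, `finrank_matrixCoeff`).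

The operator itself is β times the Casimir of su(3), plus (α - β) times the isospin Casimir, plus (γ
- β) times the square of the hypercharge, up to normalisation (`weightedCasimir_dualComponents`).
The first is scalar on the irreducible V and is computed on a highest weight vector; the other two
are scalar on each U(2)-irreducible subspace.

It remains to see that the branching to U(2) is multiplicity free. V is spanned by the monomials
E₁₀^k E₂₁^a E₂₀^b v (indices in `Fin 3`) applied to a highest weight vector (`span_monomial`).
Modulo the image of E₁₀ only k = 0 matters, and then the isospin weight and the hypercharge
determine a and b. Since the image of E₁₀ contains no nonzero primitive vector of weight n ≥ 0, each
pair (I, Y) has at most one line of primitive vectors (`exists_smul_of_primitive`).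

Group and Lie algebra are linked in both directions: continuity of π and the Lie product formula
give the derived representation (`exists_derivedRep`), and every group element is a product of two
exponentials, taken in the Lie algebra of U(2) when the element lies there
(`exists_expSU3_mul_expSU3`). Hence the invariant subspaces agree. -/

/-! ### One-parameter groups and the Lie product formula in Banach algebras -/

section BanachAlgebra

open Filter Topology

variable {A : Type*} [NormedRing A] [NormedAlgebra ℝ A] [CompleteSpace A]

/-- A continuous one-parameter group in a Banach algebra is `t ↦ exp (t a)`. -/
theorem exists_eq_exp_smul_of_continuous (F : ℝ → A) (hc : Continuous F) (h0 : F 0 = 1)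
    (hadd : ∀ s t, F (s + t) = F s * F t) :
    ∃ a : A, ∀ t : ℝ, F t = NormedSpace.exp (t • a) := by
  -- Averaging makes the merely continuous `F` differentiable: F(t) G(δ) = G(t + δ) - G(t), and G(δ)
  -- is invertible for some δ ≠ 0 because G(u)/u → F(0) = 1 and units are open.
  let G : ℝ → A := fun u => ∫ s in (0 : ℝ)..u, F s
  have hG : ∀ u, HasDerivAt G (F u) u := fun u =>
    intervalIntegral.integral_hasDerivAt_right (hc.intervalIntegrable _ _)
      (hc.stronglyMeasurableAtFilter _ _) hc.continuousAt
  have hslope : Tendsto (fun u : ℝ => u⁻¹ • G u) (𝓝[≠] 0) (𝓝 1) := by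
    have h := (hasDerivAt_iff_tendsto_slope_zero.1 (hG 0))
    simpa [G, h0] using h
  have hunit : ∀ᶠ u in 𝓝[≠] (0 : ℝ), IsUnit (u⁻¹ • G u) :=
    hslope.eventually (Units.isOpen.mem_nhds isUnit_one)
  obtain ⟨δ, hδ, hδ0⟩ := (hunit.and eventually_mem_nhdsWithin).exists
  have hδ0 : δ ≠ 0 := hδ0
  obtain ⟨B, hB⟩ : IsUnit (G δ) := by
    have h : G δ = algebraMap ℝ A δ * (δ⁻¹ • G δ) := by
      rw [← Algebra.smul_def, smul_smul, mul_inv_cancel₀ hδ0, one_smul]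
    rw [h]
    exact ((isUnit_iff_ne_zero.2 hδ0).map (algebraMap ℝ A)).mul hδ
  have hF : ∀ t, F t = (G (t + δ) - G t) * (↑B⁻¹ : A) := by
    intro t
    rw [Units.eq_mul_inv_iff_mul_eq, hB]
    have h1 : F t * G δ = ∫ s in (0 : ℝ)..δ, F (t + s) := by
      simp only [G, hadd]
      exact (((ContinuousLinearMap.mul ℝ A (F t)).intervalIntegral_comp_comm
        (hc.intervalIntegrable 0 δ))).symm
    have h2 : (∫ s in (0 : ℝ)..δ, F (t + s)) = ∫ s in t..(t + δ), F s := by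
      rw [intervalIntegral.integral_comp_add_left (fun s => F s)]
      simp
    rw [h1, h2, ← intervalIntegral.integral_interval_sub_left (a := 0)
      (hc.intervalIntegrable _ _) (hc.intervalIntegrable _ _)]
  have hd : ∃ a, HasDerivAt F a 0 := by
    refine ⟨(F δ - F 0) * (↑B⁻¹ : A), ?_⟩
    have h1 : HasDerivAt (fun t => G (t + δ)) (F δ) 0 := by
      have := (hG (0 + δ)).comp_add_const 0 δ
      simpa using this
    have h2 := (h1.sub (hG 0)).mul_const (↑B⁻¹ : A)
    exact h2.congr_of_eventuallyEq (Eventually.of_forall hF)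
  obtain ⟨a, ha⟩ := hd
  refine ⟨a, ?_⟩
  have hFd : ∀ t, HasDerivAt F (F t * a) t := by
    intro t
    have h1 : HasDerivAt (fun s => F (s - t)) a t := by
      have h := HasDerivAt.comp_sub_const t t (f := F) (f' := a) (by simpa using ha)
      exact h
    refine (h1.const_mul (F t)).congr_of_eventuallyEq (Eventually.of_forall fun s => ?_)
    simp only
    rw [← hadd]; congr 1; ring
  have hE : ∀ t : ℝ, HasDerivAt (fun s : ℝ => NormedSpace.exp (s • (-a)))
      (-a * NormedSpace.exp (t • (-a))) t := fun t => hasDerivAt_exp_smul_const' (-a) t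
  have hconst : ∀ t, F t * NormedSpace.exp (t • (-a)) = 1 := by
    intro t
    have hz : ∀ s, HasDerivAt (fun s => F s * NormedSpace.exp (s • (-a))) 0 s := by
      intro s
      have := (hFd s).mul (hE s)
      refine this.congr_deriv ?_
      noncomm_ring
    have := is_const_of_deriv_eq_zero (fun s => (hz s).differentiableAt)
      (fun s => (hz s).deriv) t 0
    simpa [h0] using this
  intro t
  let _ : NormedAlgebra ℚ A := NormedAlgebra.restrictScalars ℚ ℝ A
  have h1 : NormedSpace.exp (t • (-a)) * NormedSpace.exp (t • a) = 1 := by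
    rw [← NormedSpace.exp_add_of_commute]
    · simp
    · rw [smul_neg]; exact (Commute.refl _).neg_left
  calc F t = F t * (NormedSpace.exp (t • (-a)) * NormedSpace.exp (t • a)) := by rw [h1, mul_one]
    _ = _ := by rw [← mul_assoc, hconst, one_mul]

/-- A curve `F` through `1` with velocity `a` satisfies `F (1 / n) ^ n → exp a`. -/
theorem tendsto_pow_exp_of_hasDerivAt (hone : ‖(1 : A)‖ ≤ 1) (F : ℝ → A) (a : A) (h0 : F 0 = 1)
    (hF : HasDerivAt F a 0) :
    Tendsto (fun n : ℕ => F (1 / (n + 1 : ℝ)) ^ (n + 1)) atTop (𝓝 (NormedSpace.exp a)) := by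
  let _ : NormedAlgebra ℚ A := NormedAlgebra.restrictScalars ℚ ℝ A
  let E : ℝ → A := fun t => NormedSpace.exp (t • a)
  have hEc : Continuous E := NormedSpace.exp_continuous.comp (by fun_prop)
  have hEd : HasDerivAt E a 0 := by
    have := hasDerivAt_exp_smul_const' (𝕂 := ℝ) a (0 : ℝ)
    simpa [E] using this
  obtain ⟨K, hK⟩ : ∃ K, ∀ t ∈ Set.Icc (0 : ℝ) 1, ‖E t‖ ≤ K :=
    isCompact_Icc.exists_bound_of_continuousOn hEc.continuousOn
  have hK0 : 0 ≤ K := (norm_nonneg _).trans (hK 0 (by simp))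
  have ht : Tendsto (fun n : ℕ => 1 / ((n : ℝ) + 1)) atTop (𝓝 0) :=
    tendsto_one_div_add_atTop_nhds_zero_nat
  have hD : (fun t => F t - E t) =o[𝓝 0] (fun t : ℝ => t) := by
    have := (hF.sub hEd).isLittleO
    simpa [h0, E] using this
  have hO : (fun t => F t - 1) =O[𝓝 0] (fun t : ℝ => t) := by
    have := hF.isBigO_sub
    simpa [h0] using this
  obtain ⟨M, hM0, hM⟩ := hO.exists_pos
  have hM := ht.eventually hM.bound
  have hD := hD.comp_tendsto ht
  rw [tendsto_iff_norm_sub_tendsto_zero]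
  -- Both curves have velocity `a` at 0, so they differ by o(1/(n+1)) at time 1/(n+1). Taking powers
  -- multiplies the error by at most a constant times n + 1.
  have hbound : ∀ᶠ n : ℕ in atTop, ‖F (1 / (n + 1 : ℝ)) ^ (n + 1) - NormedSpace.exp a‖ ≤
      (K * Real.exp M) * (‖F (1 / (n + 1 : ℝ)) - E (1 / (n + 1 : ℝ))‖ / ‖1 / (n + 1 : ℝ)‖) := by
    filter_upwards [hM] with n hn
    set t : ℝ := 1 / (n + 1 : ℝ) with htdef
    have hn1 : (0 : ℝ) < n + 1 := by positivity
    have ht0 : 0 < t := by positivity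
    have htn : ((n : ℝ) + 1) * t = 1 := by rw [htdef]; field_simp
    have hEpow : ∀ k : ℕ, E t ^ k = E (k * t) := by
      intro k
      simp only [E]
      rw [← NormedSpace.exp_nsmul, mul_smul, Nat.cast_smul_eq_nsmul]
    have hA : ‖F t‖ ≤ 1 + M * t := by
      calc ‖F t‖ = ‖(F t - 1) + 1‖ := by simp
        _ ≤ ‖F t - 1‖ + ‖(1 : A)‖ := norm_add_le _ _
        _ ≤ M * ‖t‖ + 1 := add_le_add hn hone
        _ = 1 + M * t := by rw [Real.norm_of_nonneg ht0.le]; ring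
    have h1M : 1 ≤ 1 + M * t := by nlinarith [mul_pos hM0 ht0]
    -- Telescoping. The powers of E(t) stay bounded by `K`, being values of `E` on [0, 1]; those of
    -- F(t) are controlled by (1 + Mt)^k, at most exp(M) at the end.
    have hk : ∀ k : ℕ, k ≤ n + 1 →
        ‖F t ^ k - E t ^ k‖ ≤ k * (K * ‖F t - E t‖) * (1 + M * t) ^ k := by
      intro k
      induction k with
      | zero => simp
      | succ k ih =>
        intro hkn
        have hle : ‖E t ^ k‖ ≤ K := by
          rw [hEpow]
          refine hK _ ⟨by positivity, ?_⟩
          have : (k : ℝ) ≤ n + 1 := by exact_mod_cast (by omega : k ≤ n + 1)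
          rw [← htn]
          exact mul_le_mul_of_nonneg_right this ht0.le
        have e : F t ^ (k + 1) - E t ^ (k + 1)
            = (F t ^ k - E t ^ k) * F t + E t ^ k * (F t - E t) := by
          rw [pow_succ, pow_succ]; noncomm_ring
        have hpow : 1 ≤ (1 + M * t) ^ (k + 1) := one_le_pow₀ h1M
        calc ‖F t ^ (k + 1) - E t ^ (k + 1)‖
            ≤ ‖F t ^ k - E t ^ k‖ * ‖F t‖ + ‖E t ^ k‖ * ‖F t - E t‖ := by
              rw [e]
              exact (norm_add_le _ _).trans (add_le_add (norm_mul_le _ _) (norm_mul_le _ _))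
          _ ≤ (k * (K * ‖F t - E t‖) * (1 + M * t) ^ k) * (1 + M * t)
              + K * ‖F t - E t‖ * (1 + M * t) ^ (k + 1) := by
              refine add_le_add (mul_le_mul (ih (by omega)) hA (norm_nonneg _) (by positivity)) ?_
              calc ‖E t ^ k‖ * ‖F t - E t‖ ≤ K * ‖F t - E t‖ :=
                    mul_le_mul_of_nonneg_right hle (norm_nonneg _)
                _ ≤ _ := le_mul_of_one_le_right (by positivity) hpow
          _ = _ := by push_cast; ring
    have hfin := hk (n + 1) le_rfl
    rw [hEpow] at hfin
    have hE1 : E (((n + 1 : ℕ) : ℝ) * t) = NormedSpace.exp a := by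
      push_cast
      rw [htn]; simp [E]
    rw [hE1] at hfin
    have hexp : (1 + M * t) ^ (n + 1) ≤ Real.exp M := by
      calc (1 + M * t) ^ (n + 1) ≤ (Real.exp (M * t)) ^ (n + 1) := by
            refine pow_le_pow_left₀ (by positivity) ?_ _
            have := Real.add_one_le_exp (M * t); linarith
        _ = Real.exp M := by
            rw [← Real.exp_nat_mul]; congr 1; push_cast
            linear_combination M * htn
    refine hfin.trans ?_
    rw [Real.norm_of_nonneg ht0.le]
    have e2 : ‖F t - E t‖ / t = (n + 1) * ‖F t - E t‖ := by
      rw [htdef]; field_simp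
    rw [e2]
    calc ((n + 1 : ℕ) : ℝ) * (K * ‖F t - E t‖) * (1 + M * t) ^ (n + 1)
        ≤ ((n + 1 : ℕ) : ℝ) * (K * ‖F t - E t‖) * Real.exp M :=
          mul_le_mul_of_nonneg_left hexp (by positivity)
      _ = _ := by push_cast; ring
  have hz : Tendsto (fun n : ℕ => (K * Real.exp M) *
      (‖F (1 / (n + 1 : ℝ)) - E (1 / (n + 1 : ℝ))‖ / ‖1 / (n + 1 : ℝ)‖)) atTop (𝓝 0) := by
    have h := hD.norm_norm.tendsto_div_nhds_zero
    have := h.const_mul (K * Real.exp M)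
    simpa using this
  exact squeeze_zero' (Eventually.of_forall fun _ => norm_nonneg _) hbound hz

/-- The Lie product formula. -/
theorem tendsto_exp_mul_exp_pow (hone : ‖(1 : A)‖ ≤ 1) (x y : A) :
    Tendsto (fun n : ℕ => (NormedSpace.exp ((1 / (n + 1 : ℝ)) • x) *
      NormedSpace.exp ((1 / (n + 1 : ℝ)) • y)) ^ (n + 1)) atTop (𝓝 (NormedSpace.exp (x + y))) := by
  refine tendsto_pow_exp_of_hasDerivAt hone
    (fun t => NormedSpace.exp (t • x) * NormedSpace.exp (t • y)) (x + y) (by simp) ?_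
  have hx := hasDerivAt_exp_smul_const' (𝕂 := ℝ) x (0 : ℝ)
  have hy := hasDerivAt_exp_smul_const' (𝕂 := ℝ) y (0 : ℝ)
  have h := hx.mul hy
  simp only [zero_smul, NormedSpace.exp_zero, mul_one, one_mul] at h
  exact h

end BanachAlgebra

/-! ### Logarithms of unitary matrices; exponentials generate SU(3) -/

section MatrixLogarithm

open scoped Matrix.Norms.L2Operator

/-- Every unitary matrix has a skew-Hermitian logarithm which commutes with all Hermitian matrices
that commute with it. -/
theorem exists_isHermitian_exp_eq {n : Type*} [Fintype n] [DecidableEq n] (u : Matrix n n ℂ)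
    (hu : u ∈ Matrix.unitaryGroup n ℂ) :
    ∃ H : Matrix n n ℂ, H.IsHermitian ∧ NormedSpace.exp (Complex.I • H) = u ∧
      ∀ b : Matrix n n ℂ, b.IsHermitian → Commute b u → Commute b H := by
  have hfin : (spectrum ℂ u).Finite := Matrix.finite_spectrum u
  -- `Complex.arg` jumps across the negative axis, but every function is continuous on a finite
  -- spectrum, so the functional calculus applies to it.
  have hcont : ∀ f : ℂ → ℂ, ContinuousOn f (spectrum ℂ u) := fun f => hfin.continuousOn f
  have hn : IsStarNormal u := ⟨by
    have h1 := Matrix.mem_unitaryGroup_iff.1 hu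
    have h2 := Matrix.mem_unitaryGroup_iff'.1 hu
    rw [Commute, SemiconjBy, h1, h2]⟩
  refine ⟨cfc (fun z : ℂ => (Complex.arg z : ℂ)) u, IsSelfAdjoint.cfc_arg u, ?_, ?_⟩
  · rw [← cfc_const_mul Complex.I (fun z : ℂ => (Complex.arg z : ℂ)) u (hcont _)]
    rw [← CFC.exp_eq_normedSpace_exp (𝕜 := ℂ)
      (a := cfc (fun z : ℂ => Complex.I * (Complex.arg z : ℂ)) u) (cfc_predicate _ _),
      ← Complex.exp_eq_exp_ℂ,
      ← cfc_comp' Complex.exp (fun z : ℂ => Complex.I * (Complex.arg z : ℂ)) u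
        (Complex.continuous_exp.continuousOn) (hcont _)]
    conv_rhs => rw [← cfc_id' ℂ u]
    refine cfc_congr fun z hz => ?_
    have hz1 : ‖z‖ = 1 := spectrum.norm_eq_one_of_unitary hu hz
    have h := Complex.norm_mul_exp_arg_mul_I z
    rw [hz1] at h
    rw [mul_comm]
    simpa using h
  · intro b hb hbu
    -- The functional calculus of a normal `u` requires commutation with `star u` too, which follows
    -- by taking adjoints since `b` is Hermitian.
    refine (Commute.cfc hbu.symm ?_ _).symm
    have h := hbu.star_star
    rw [Matrix.star_eq_conjTranspose, hb.eq] at h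
    exact h.symm

end MatrixLogarithm

/-- Block-diagonal matrices commute with the third diagonal matrix unit. -/
theorem commute_single_of_mem_U2 {g : SU3} (hg : g ∈ U2) :
    Commute (Matrix.single 2 2 (1 : ℂ)) g.1 := by
  obtain ⟨h1, h2, h3, h4⟩ := hg
  ext i j
  fin_cases i <;> fin_cases j <;> simp [Matrix.mul_apply, Matrix.single_apply,
    h1, h2, h3, h4]

/-- Every element of `SU(3)` is a product of two exponentials, which can be chosen in the Lie
algebra of `U2` for elements of `U2`. -/
theorem exists_expSU3_mul_expSU3 (g : SU3) :
    ∃ x y : su3, g = expSU3 x * expSU3 y ∧ (g ∈ U2 →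
      Commute (Matrix.single 2 2 (1 : ℂ)) x.1 ∧ Commute (Matrix.single 2 2 (1 : ℂ)) y.1) := by
  obtain ⟨hgu, hgd⟩ := Matrix.mem_specialUnitaryGroup_iff.1 g.2
  obtain ⟨H, hH, hexp, hcomm⟩ := exists_isHermitian_exp_eq g.1 hgu
  -- The logarithm of `g` need not be traceless. Removing its trace leaves a scalar factor exp(iτ),
  -- which is why a second exponential appears.
  set τ : ℂ := H.trace / 3 with hτ
  have hτr : star τ = τ := by
    have h : star H.trace = H.trace := by
      rw [← Matrix.trace_conjTranspose, hH.eq]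
    rw [hτ, star_div₀, h]; simp
  have hx : (Complex.I • (H - τ • (1 : Matrix (Fin 3) (Fin 3) ℂ)))ᴴ
      = -(Complex.I • (H - τ • (1 : Matrix (Fin 3) (Fin 3) ℂ))) := by
    rw [Matrix.conjTranspose_smul, Matrix.conjTranspose_sub, hH.eq, Matrix.conjTranspose_smul,
      hτr]
    simp
  have hxt : (Complex.I • (H - τ • (1 : Matrix (Fin 3) (Fin 3) ℂ))).trace = 0 := by
    rw [Matrix.trace_smul, Matrix.trace_sub, Matrix.trace_smul, Matrix.trace_one, hτ]
    simp
  have hsplit : g.1 = NormedSpace.exp (Complex.I • (H - τ • (1 : Matrix (Fin 3) (Fin 3) ℂ))) *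
      NormedSpace.exp ((Complex.I * τ) • (1 : Matrix (Fin 3) (Fin 3) ℂ)) := by
    rw [← Matrix.exp_add_of_commute, ← hexp]
    · congr 1
      rw [smul_sub, smul_smul, sub_add_cancel]
    · exact (Commute.one_right _).smul_right _
  have hdiag : ((Complex.I * τ) • (1 : Matrix (Fin 3) (Fin 3) ℂ))
      = Matrix.diagonal fun _ => Complex.I * τ := by
    ext i j; simp [Matrix.diagonal_apply, Matrix.one_apply]
  have hexpτ : NormedSpace.exp ((Complex.I * τ) • (1 : Matrix (Fin 3) (Fin 3) ℂ))
      = Matrix.diagonal fun _ => Complex.exp (Complex.I * τ) := by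
    rw [hdiag, Matrix.exp_diagonal]
    congr 1
    ext i
    simp [Pi.coe_exp, Complex.exp_eq_exp_ℂ]
  -- Both `g` and the traceless exponential have determinant 1, so the scalar factor is a cube root
  -- of unity.
  have hdet : Complex.exp (Complex.I * τ) ^ 3 = 1 := by
    have h := congrArg Matrix.det hsplit
    rw [hgd, Matrix.det_mul, det_exp_su3 _ hx hxt, hexpτ, Matrix.det_diagonal] at h
    simpa using h.symm
  -- the central factor is the exponential of a multiple of `i diag(1, 1, -2)`
  let D : Matrix (Fin 3) (Fin 3) ℂ := Matrix.diagonal ![Complex.I * τ, Complex.I * τ,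
    -(2 * (Complex.I * τ))]
  have hDexp : NormedSpace.exp D =
      NormedSpace.exp ((Complex.I * τ) • (1 : Matrix (Fin 3) (Fin 3) ℂ)) := by
    rw [hexpτ, Matrix.exp_diagonal]
    congr 1
    ext i
    rw [Pi.coe_exp, ← Complex.exp_eq_exp_ℂ]
    fin_cases i
    · rfl
    · rfl
    · simp only [Fin.reduceFinMk, Matrix.cons_val]
      -- The third diagonal entry agrees because exp(-2iτ) = exp(-2iτ) exp(3iτ) = exp(iτ).
      rw [← mul_one (Complex.exp (-(2 * (Complex.I * τ)))), ← hdet, ← Complex.exp_nat_mul,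
        ← Complex.exp_add]
      congr 1
      push_cast
      ring
  have hDH : Dᴴ = -D := by
    have : star τ = τ := hτr
    have h2 : (starRingEnd ℂ) τ = τ := hτr
    ext i j
    fin_cases i <;> fin_cases j <;> simp [D, Matrix.conjTranspose_apply, h2]
  have hDt : D.trace = 0 := by
    simp [D, Matrix.trace, Fin.sum_univ_three]; ring
  refine ⟨⟨_, hx, hxt⟩, ⟨D, hDH, hDt⟩, ?_, fun hg => ⟨?_, ?_⟩⟩
  · apply Subtype.ext
    change g.1 = NormedSpace.exp (Complex.I • (H - τ • (1 : Matrix (Fin 3) (Fin 3) ℂ))) *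
      NormedSpace.exp D
    rw [hDexp, hsplit]
  · refine Commute.smul_right (Commute.sub_right (hcomm _ ?_ (commute_single_of_mem_U2 hg))
      ((Commute.one_right _).smul_right _)) _
    ext i j; fin_cases i <;> fin_cases j <;> simp [Matrix.conjTranspose_apply]
  · rw [← Matrix.diagonal_single]
    exact Matrix.commute_diagonal _ _

/-! ### The exponential map and the adjoint action of SU(3) -/

section Exponential

open Filter Topology

attribute [local instance] Matrix.linftyOpNormedRing Matrix.linftyOpNormedAlgebra

theorem norm_one_matrix_le : ‖(1 : Matrix (Fin 3) (Fin 3) ℂ)‖ ≤ 1 := by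
  rw [← Matrix.diagonal_one, Matrix.linfty_opNorm_diagonal]
  exact (pi_norm_const_le (1 : ℂ)).trans (by simp)

theorem expSU3_zero : expSU3 0 = 1 := by
  apply Subtype.ext
  change NormedSpace.exp (0 : Matrix (Fin 3) (Fin 3) ℂ) = 1
  simp

theorem expSU3_add_smul (x : su3) (s t : ℝ) :
    expSU3 ((s + t) • x) = expSU3 (s • x) * expSU3 (t • x) := by
  apply Subtype.ext
  change NormedSpace.exp ((s + t) • x.1) = NormedSpace.exp (s • x.1) * NormedSpace.exp (t • x.1)
  rw [← Matrix.exp_add_of_commute, add_smul]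
  exact ((Commute.refl _).smul_left _).smul_right _

theorem continuous_matrix_exp :
    Continuous (NormedSpace.exp : Matrix (Fin 3) (Fin 3) ℂ → Matrix (Fin 3) (Fin 3) ℂ) := by
  let _ : NormedAlgebra ℚ (Matrix (Fin 3) (Fin 3) ℂ) := NormedAlgebra.restrictScalars ℚ ℝ _
  exact NormedSpace.exp_continuous

theorem continuous_expSU3_smul (x : su3) : Continuous fun t : ℝ => expSU3 (t • x) := by
  refine Continuous.subtype_mk (continuous_matrix_exp.comp (?_ : Continuous fun t : ℝ => t • x.1)) _
  fun_prop

/-- The Lie product formula in `SU(3)`. -/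
theorem tendsto_expSU3_mul_pow (x y : su3) :
    Tendsto (fun n : ℕ => (expSU3 ((1 / (n + 1 : ℝ)) • x) *
      expSU3 ((1 / (n + 1 : ℝ)) • y)) ^ (n + 1)) atTop (𝓝 (expSU3 (x + y))) := by
  rw [tendsto_subtype_rng]
  exact tendsto_exp_mul_exp_pow norm_one_matrix_le x.1 y.1

/-- The adjoint action of `SU(3)` on its Lie algebra. -/
def adSU3 (g : SU3) (x : su3) : su3 :=
  ⟨g.1 * x.1 * star g.1, by
    have hx : x.1ᴴ = -x.1 := x.2.1
    have hg := Matrix.mem_unitaryGroup_iff'.1 (Matrix.mem_specialUnitaryGroup_iff.1 g.2).1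
    refine ⟨?_, ?_⟩
    · rw [Matrix.conjTranspose_mul, Matrix.conjTranspose_mul, hx, Matrix.star_eq_conjTranspose,
        Matrix.conjTranspose_conjTranspose]
      simp [Matrix.mul_assoc]
    · have ht : x.1.trace = 0 := x.2.2
      rw [Matrix.trace_mul_comm, ← Matrix.mul_assoc, hg, Matrix.one_mul, ht]⟩

theorem expSU3_adSU3 (g : SU3) (x : su3) : expSU3 (adSU3 g x) = g * expSU3 x * g⁻¹ := by
  have hg := (Matrix.mem_specialUnitaryGroup_iff.1 g.2).1
  have h1 := Matrix.mem_unitaryGroup_iff.1 hg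
  have h2 : g.1⁻¹ = star g.1 := Matrix.inv_eq_right_inv h1
  apply Subtype.ext
  change NormedSpace.exp (g.1 * x.1 * star g.1) = g.1 * NormedSpace.exp x.1 * star g.1
  rw [← h2, Matrix.exp_conj _ _ (IsUnit.of_mul_eq_one _ h1)]

/-- Differentiating Ad(exp(ty)) x yields the bracket [y, x]. Comparison with the same derivative
computed inside a representation shows that the derived map respects brackets. -/
theorem hasDerivAt_adSU3 (x y : su3) :
    HasDerivAt (fun t : ℝ => (adSU3 (expSU3 (t • y)) x).1) (y.1 * x.1 - x.1 * y.1) 0 := by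
  have h1 := hasDerivAt_exp_smul_const' (𝕂 := ℝ) y.1 (0 : ℝ)
  have h2 := hasDerivAt_exp_smul_const' (𝕂 := ℝ) (-y.1) (0 : ℝ)
  have h3 := (h1.mul_const x.1).mul h2
  have hy : y.1ᴴ = -y.1 := y.2.1
  have e : (fun t : ℝ => (adSU3 (expSU3 (t • y)) x).1) = (fun t : ℝ =>
      NormedSpace.exp (t • y.1) * x.1 * NormedSpace.exp (t • (-y.1))) := by
    funext t
    change NormedSpace.exp (t • y.1) * x.1 * (NormedSpace.exp (t • y.1))ᴴ = _
    rw [← Matrix.exp_conjTranspose, Matrix.conjTranspose_smul, hy]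
    simp
  rw [e]
  refine h3.congr_deriv ?_
  simp [sub_eq_add_neg]

end Exponential

/-! ### The derived representation of su(3) -/

section Generator

open Filter Topology

attribute [local instance 100] LieRing.ofAssociativeRing

theorem hasDerivAt_exp_smul_zero {A : Type*} [NormedRing A] [NormedAlgebra ℝ A] [CompleteSpace A]
    (a : A) : HasDerivAt (fun t : ℝ => NormedSpace.exp (t • a)) a 0 := by
  simpa using hasDerivAt_exp_smul_const' (𝕂 := ℝ) a (0 : ℝ)

/-- A one-parameter group determines its generator, namely its velocity at 0. Linearity and
equivariance of the derived map are all checked through this. -/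
theorem eq_of_exp_smul_eq {A : Type*} [NormedRing A] [NormedAlgebra ℝ A] [CompleteSpace A]
    {a b : A} (h : ∀ t : ℝ, NormedSpace.exp (t • a) = NormedSpace.exp (t • b)) : a = b := by
  have h2 := hasDerivAt_exp_smul_zero b
  simp_rw [← h] at h2
  exact (hasDerivAt_exp_smul_zero a).unique h2

variable {V : Type*} [NormedAddCommGroup V] [NormedSpace ℂ V] [FiniteDimensional ℂ V]

/-- The operators of a finite-dimensional representation as continuous linear maps. -/
noncomputable def repCLM (π : Representation ℂ SU3 V) (g : SU3) : V →L[ℂ] V :=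
  LinearMap.toContinuousLinearMap (π g)

theorem repCLM_apply (π : Representation ℂ SU3 V) (g : SU3) (v : V) : repCLM π g v = π g v := rfl

theorem repCLM_mul (π : Representation ℂ SU3 V) (g h : SU3) :
    repCLM π (g * h) = repCLM π g * repCLM π h := by
  ext v; simp [repCLM_apply]

theorem repCLM_one (π : Representation ℂ SU3 V) : repCLM π 1 = 1 := by
  ext v; simp [repCLM_apply]

theorem repCLM_pow (π : Representation ℂ SU3 V) (g : SU3) (n : ℕ) :
    repCLM π (g ^ n) = repCLM π g ^ n := by
  induction n with
  | zero => rw [pow_zero, pow_zero, repCLM_one]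
  | succ n ih => rw [pow_succ, pow_succ, repCLM_mul, ih]

theorem continuous_repCLM (π : Representation ℂ SU3 V)
    (hπ : ∀ v : V, Continuous fun g : SU3 => π g v) : Continuous (repCLM π) :=
  continuous_clm_apply.2 hπ

/-- A continuous finite-dimensional representation of `SU(3)` is the exponential of a
representation of its Lie algebra. -/
theorem exists_derivedRep (π : Representation ℂ SU3 V)
    (hπ : ∀ v : V, Continuous fun g : SU3 => π g v) :
    ∃ ρ : su3 →ₗ[ℝ] (V →L[ℂ] V), (∀ x, repCLM π (expSU3 x) = NormedSpace.exp (ρ x)) ∧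
      ∀ x y, ρ ⁅x, y⁆ = ρ x * ρ y - ρ y * ρ x := by
  have : CompleteSpace V := FiniteDimensional.complete ℂ V
  have hP := continuous_repCLM π hπ
  have hex : ∀ x : su3, ∃ a : V →L[ℂ] V, ∀ t : ℝ,
      repCLM π (expSU3 (t • x)) = NormedSpace.exp (t • a) := fun x =>
    exists_eq_exp_smul_of_continuous (fun t => repCLM π (expSU3 (t • x)))
      (hP.comp (continuous_expSU3_smul x)) (by simp [expSU3_zero, repCLM_one])
      (fun s t => by rw [expSU3_add_smul, repCLM_mul])
  choose a ha using hex
  have hsmul : ∀ (c : ℝ) x, a (c • x) = c • a x := by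
    intro c x
    refine eq_of_exp_smul_eq fun t => ?_
    rw [← ha, smul_smul, ha, smul_smul]
  have ha1 : ∀ x, repCLM π (expSU3 x) = NormedSpace.exp (a x) := by
    intro x
    simpa using ha x 1
  -- The Lie product formula in SU(3), pushed forward by the continuous π, and the formula in the
  -- endomorphism algebra are limits of the same sequence.
  have hadd1 : ∀ x y, repCLM π (expSU3 (x + y)) = NormedSpace.exp (a x + a y) := by
    intro x y
    have h1 := (hP.tendsto _).comp (tendsto_expSU3_mul_pow x y)
    have h2 := tendsto_exp_mul_exp_pow (A := V →L[ℂ] V) ContinuousLinearMap.norm_id_le (a x) (a y)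
    refine tendsto_nhds_unique h1 (h2.congr fun n => ?_)
    rw [Function.comp_apply, repCLM_pow, repCLM_mul, ha, ha]
  have hadd : ∀ x y, a (x + y) = a x + a y := by
    intro x y
    refine eq_of_exp_smul_eq fun t => ?_
    rw [← ha, smul_add, hadd1, hsmul, hsmul, smul_add]
  let ρ : su3 →ₗ[ℝ] (V →L[ℂ] V) := { toFun := a, map_add' := hadd, map_smul' := hsmul }
  refine ⟨ρ, ha1, fun y x => ?_⟩
  have hAd : ∀ g, a (adSU3 g x) = repCLM π g * a x * repCLM π g⁻¹ := by
    intro g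
    have hgg : repCLM π g * repCLM π g⁻¹ = 1 := by rw [← repCLM_mul, mul_inv_cancel, repCLM_one]
    have hgg' : repCLM π g⁻¹ * repCLM π g = 1 := by rw [← repCLM_mul, inv_mul_cancel, repCLM_one]
    let U : (V →L[ℂ] V)ˣ := ⟨repCLM π g, repCLM π g⁻¹, hgg, hgg'⟩
    let _ : NormedAlgebra ℚ (V →L[ℂ] V) := NormedAlgebra.restrictScalars ℚ ℝ _
    refine eq_of_exp_smul_eq fun t => ?_
    have h1 : t • (repCLM π g * a x * repCLM π g⁻¹) =
        (U : V →L[ℂ] V) * (t • a x) * (↑U⁻¹ : V →L[ℂ] V) := by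
      rw [mul_smul_comm, smul_mul_assoc]; rfl
    rw [h1, NormedSpace.exp_units_conj, ← hsmul, ← hsmul, ← ha1, ← ha1]
    have h2 : t • adSU3 g x = adSU3 g (t • x) := by
      apply Subtype.ext
      change t • (g.1 * x.1 * star g.1) = g.1 * (t • x.1) * star g.1
      rw [mul_smul_comm, smul_mul_assoc]
    rw [h2, expSU3_adSU3, repCLM_mul, repCLM_mul]
    rfl
  -- The derivative of the adjoint action is known in the space of all matrices, so the derived map
  -- is extended linearly there before the chain rule is applied.
  obtain ⟨ρ', hρ'⟩ := LinearMap.exists_extend (p := su3.toSubmodule) ρ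
  have hρ'x : ∀ z : su3, ρ' z.1 = a z := fun z => congrArg (fun f => f z) hρ'
  have hd1 : HasDerivAt (fun t : ℝ => a (adSU3 (expSU3 (t • y)) x))
      (ρ' (y.1 * x.1 - x.1 * y.1)) 0 := by
    let _ : NormedRing (Matrix (Fin 3) (Fin 3) ℂ) := Matrix.linftyOpNormedRing
    let _ : NormedAlgebra ℝ (Matrix (Fin 3) (Fin 3) ℂ) := Matrix.linftyOpNormedAlgebra
    have := (LinearMap.toContinuousLinearMap ρ').hasFDerivAt.comp_hasDerivAt (0 : ℝ)
      (hasDerivAt_adSU3 x y)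
    refine this.congr_of_eventuallyEq (Eventually.of_forall fun t => ?_)
    exact (hρ'x _).symm
  have hd2 : HasDerivAt (fun t : ℝ => a (adSU3 (expSU3 (t • y)) x)) (a y * a x - a x * a y) 0 := by
    have h1 := ((hasDerivAt_exp_smul_zero (a y)).mul_const (a x)).mul
      (hasDerivAt_exp_smul_zero (-(a y)))
    refine (h1.congr_of_eventuallyEq (Eventually.of_forall fun t => ?_)).congr_deriv ?_
    · have hinv : (expSU3 (t • y))⁻¹ = expSU3 ((-t) • y) := by
        rw [inv_eq_iff_mul_eq_one, ← expSU3_add_smul]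
        simp [expSU3_zero]
      simp only [hAd, hinv, ha, Pi.mul_apply]
      rw [smul_neg, neg_smul]
    · simp [sub_eq_add_neg]
  exact (hρ'x ⁅y, x⁆).symm.trans (hd1.unique hd2)

end Generator

/-! ### Finite-dimensional representations of gl(2) -/

section GL2

variable {V : Type*} [AddCommGroup V] [Module ℂ V]

/-- The commutation relations of `gl(2) = sl(2) ⊕ ℂ c`, for operators on a vector space. -/
structure GL2Action (e f h c : Module.End ℂ V) : Prop where
  ef : ∀ x, e (f x) = f (e x) + h x
  he : ∀ x, h (e x) = e (h x) + (2 : ℂ) • e x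
  hf : ∀ x, h (f x) = f (h x) - (2 : ℂ) • f x
  ce : ∀ x, c (e x) = e (c x)
  cf : ∀ x, c (f x) = f (c x)
  ch : ∀ x, c (h x) = h (c x)

/-- The weight spaces with integral weights `j` of `h` and `q` of `c`. -/
def weightSpace (h c : Module.End ℂ V) (j q : ℤ) : Submodule ℂ V :=
  Module.End.eigenspace h (j : ℂ) ⊓ Module.End.eigenspace c (q : ℂ)

theorem mem_weightSpace {h c : Module.End ℂ V} {j q : ℤ} {x : V} :
    x ∈ weightSpace h c j q ↔ h x = (j : ℂ) • x ∧ c x = (q : ℂ) • x := by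
  simp [weightSpace]

/-- There are finitely many eigenvalues in finite dimension. Since `e` and `f` shift the weight by
2, this bound is what makes repeated raising terminate. -/
theorem exists_bound_weight [FiniteDimensional ℂ V] (h : Module.End ℂ V) :
    ∃ B : ℕ, ∀ (j : ℤ) (x : V), h x = (j : ℂ) • x → (B : ℤ) < |j| → x = 0 := by
  have hfin : {j : ℤ | Module.End.HasEigenvalue h (j : ℂ)}.Finite :=
    (Module.End.finite_hasEigenvalue h).preimage (Int.cast_injective.injOn)
  obtain ⟨B, hB⟩ := (hfin.image Int.natAbs).bddAbove
  refine ⟨B, fun j x hx hj => ?_⟩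
  by_contra hne
  have h1 : Module.End.HasEigenvalue h (j : ℂ) :=
    Module.End.hasEigenvalue_of_hasEigenvector ⟨Module.End.mem_eigenspace_iff.2 hx, hne⟩
  have h2 : j.natAbs ≤ B := hB (Set.mem_image_of_mem _ h1)
  rw [Int.abs_eq_natAbs] at hj
  omega

namespace GL2Action

variable {e f h c : Module.End ℂ V}

/-- The Weyl reflection. It transfers statements about positive weights to negative ones. -/
theorem symm (T : GL2Action e f h c) : GL2Action f e (-h) c where
  ef x := by simp [T.ef]
  he x := by simp [T.hf]; abel
  hf x := by simp [T.he]; abel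
  ce := T.cf
  cf := T.ce
  ch x := by simp [T.ch]

theorem weightSpace_neg {j q : ℤ} : weightSpace (-h) c (-j) q = weightSpace h c j q := by
  ext x
  simp [mem_weightSpace]

theorem e_mem (T : GL2Action e f h c) {j q : ℤ} {x : V} (hx : x ∈ weightSpace h c j q) :
    e x ∈ weightSpace h c (j + 2) q := by
  rw [mem_weightSpace] at hx ⊢
  refine ⟨?_, ?_⟩
  · rw [T.he, hx.1, map_smul]; push_cast; module
  · rw [T.ce, hx.2, map_smul]

theorem f_mem (T : GL2Action e f h c) {j q : ℤ} {x : V} (hx : x ∈ weightSpace h c j q) :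
    f x ∈ weightSpace h c (j - 2) q := by
  rw [mem_weightSpace] at hx ⊢
  refine ⟨?_, ?_⟩
  · rw [T.hf, hx.1, map_smul]; push_cast; module
  · rw [T.cf, hx.2, map_smul]

/-- The operator `e f` is injective on positive weight spaces. -/
theorem eq_zero_of_ef_eq_zero [FiniteDimensional ℂ V] (T : GL2Action e f h c)
    {j q : ℤ} (hj : 0 < j) {y : V}
    (hy : y ∈ weightSpace h c j q) (h0 : e (f y) = 0) : y = 0 := by
  obtain ⟨B, hB⟩ := exists_bound_weight h
  -- From e f y = 0 one gets f e y = -j y, and inductively f e acts on e^k y by a negative integer.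
  -- So e^(k+1) y = 0 forces e^k y = 0; as the weights j + 2k leave the bounded range, the descent
  -- ends at y = 0.
  have hstep : ∀ k : ℕ, (e ^ k) y ∈ weightSpace h c (j + 2 * k) q ∧
      ∃ l : ℤ, l < 0 ∧ f (e ((e ^ k) y)) = (l : ℂ) • (e ^ k) y := by
    intro k
    induction k with
    | zero =>
      refine ⟨by simpa using hy, -j, by omega, ?_⟩
      have h1 := T.ef y
      rw [h0, (mem_weightSpace.1 hy).1] at h1
      simpa using eq_neg_of_add_eq_zero_left h1.symm
    | succ k ih =>
      obtain ⟨hk, l, hl, hfe⟩ := ih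
      have hk1 := T.e_mem hk
      rw [pow_succ', Module.End.mul_apply]
      refine ⟨by convert hk1 using 1; push_cast; ring_nf, l - (j + 2 * k + 2), by omega, ?_⟩
      have h1 := T.ef (e ((e ^ k) y))
      rw [hfe, map_smul, (mem_weightSpace.1 hk1).1] at h1
      rw [eq_sub_of_add_eq h1.symm]
      push_cast; module
  have hzero : ∀ k : ℕ, (e ^ k) y = 0 → y = 0 := by
    intro k
    induction k with
    | zero => intro hk; simpa using hk
    | succ k ih =>
      intro hk
      obtain ⟨-, l, hl, hfe⟩ := hstep k
      rw [pow_succ', Module.End.mul_apply] at hk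
      rw [hk, map_zero] at hfe
      refine ih ((smul_eq_zero.1 hfe.symm).resolve_left ?_)
      exact_mod_cast hl.ne
  refine hzero (B + 1) (hB _ _ (mem_weightSpace.1 (hstep (B + 1)).1).1 ?_)
  rw [abs_of_pos (by positivity)]
  push_cast; omega

/-- The operator `e f` is surjective on positive weight spaces. -/
theorem exists_ef_eq [FiniteDimensional ℂ V] (T : GL2Action e f h c)
    {j q : ℤ} (hj : 0 < j) {x : V}
    (hx : x ∈ weightSpace h c j q) : ∃ y ∈ weightSpace h c j q, e (f y) = x := by
  have hmap : ∀ y ∈ weightSpace h c j q, (e * f) y ∈ weightSpace h c j q := by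
    intro y hy
    have := T.e_mem (T.f_mem hy)
    rwa [sub_add_cancel] at this
  have hinj : Function.Injective ((e * f).restrict hmap) := by
    rw [injective_iff_map_eq_zero]
    intro y hy
    exact Subtype.ext (T.eq_zero_of_ef_eq_zero hj y.2 (congrArg Subtype.val hy))
  obtain ⟨y, hy⟩ := LinearMap.injective_iff_surjective.1 hinj ⟨x, hx⟩
  exact ⟨y.1, y.2, congrArg Subtype.val hy⟩

theorem eq_zero_of_e_eq_zero [FiniteDimensional ℂ V] (T : GL2Action e f h c)
    {j q : ℤ} (hj : j < 0) {x : V}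
    (hx : x ∈ weightSpace h c j q) (h0 : e x = 0) : x = 0 := by
  refine T.symm.eq_zero_of_ef_eq_zero (j := -j) (q := q) (by omega) ?_ (by rw [h0, map_zero])
  rwa [weightSpace_neg]

/-- This is what separates primitive vectors from the image of `f`: two primitive vectors of weight
n ≥ 0 that agree modulo `f` of weight n + 2 are equal. -/
theorem eq_zero_of_primitive_f [FiniteDimensional ℂ V] (T : GL2Action e f h c)
    {n : ℕ} {q : ℤ} {y : V}
    (hy : y ∈ weightSpace h c (n + 2) q) (h0 : e (f y) = 0) : f y = 0 := by
  rw [T.eq_zero_of_ef_eq_zero (by positivity) hy h0, map_zero]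

/-- A submodule stable under `f` which contains the primitive vectors contains all weight
vectors. -/
theorem weightSpace_le [FiniteDimensional ℂ V] (T : GL2Action e f h c)
    (P : Submodule ℂ V) (hf : ∀ x ∈ P, f x ∈ P)
    (hprim : ∀ (n : ℕ) (q : ℤ), ∀ x ∈ weightSpace h c n q, e x = 0 → x ∈ P) (j q : ℤ) :
    weightSpace h c j q ≤ P := by
  obtain ⟨B, hB⟩ := exists_bound_weight h
  -- Descending induction on the weight, started above the bound `B`. In negative weight, f e is
  -- surjective, so x lies in the image of `f`. In weight j ≥ 0, some y of weight j + 2 has e f y =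
  -- e x, and x - f y is primitive.
  suffices hmain : ∀ (d : ℕ) (j : ℤ), (B : ℤ) - j < d → weightSpace h c j q ≤ P by
    refine hmain (B - j + 1).toNat j ?_
    omega
  intro d
  induction d with
  | zero =>
    intro j hj x hx
    rw [hB j x (mem_weightSpace.1 hx).1 (by rw [lt_abs]; left; push_cast at hj; omega)]
    exact P.zero_mem
  | succ d ih =>
    intro j hj x hx
    have ih' := ih (j + 2) (by push_cast at hj; omega)
    rcases lt_or_ge j 0 with hneg | hpos
    · have hx' : x ∈ weightSpace (-h) c (-j) q := by rwa [weightSpace_neg]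
      obtain ⟨y, hy, rfl⟩ := T.symm.exists_ef_eq (by omega) hx'
      rw [weightSpace_neg] at hy
      exact hf _ (ih' (T.e_mem hy))
    · obtain ⟨y, hy, hxy⟩ := T.exists_ef_eq (by omega) (T.e_mem hx)
      have hfy : f y ∈ weightSpace h c j q := by
        have := T.f_mem hy
        rwa [add_sub_cancel_right] at this
      obtain ⟨n, rfl⟩ := Int.eq_ofNat_of_zero_le hpos
      have h1 := hprim n q (x - f y) (Submodule.sub_mem _ hx hfy) (by
        rw [map_sub, hxy, sub_self])
      simpa using P.add_mem h1 (hf _ (ih' hy))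

section Primitive

variable {n : ℕ} {q : ℤ} {w : V}

theorem f_pow_mem (T : GL2Action e f h c) (hw : w ∈ weightSpace h c n q) (k : ℕ) :
    (f ^ k) w ∈ weightSpace h c (n - 2 * k) q := by
  induction k with
  | zero => simpa using hw
  | succ k ih =>
    rw [pow_succ', Module.End.mul_apply]
    convert T.f_mem ih using 1
    push_cast; ring_nf

/-- The coefficient (k + 1)(n - k) is nonzero for k < n and vanishes at k = n: this is why the chain
starting at a primitive vector of weight n has exactly n + 1 members. -/
theorem e_f_pow (T : GL2Action e f h c) (hw : w ∈ weightSpace h c n q) (h0 : e w = 0) (k : ℕ) :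
    e ((f ^ (k + 1)) w) = ((k + 1) * (n - k) : ℂ) • (f ^ k) w := by
  induction k with
  | zero =>
    simp only [zero_add, pow_one, pow_zero, Module.End.one_apply]
    rw [T.ef, h0, map_zero, (mem_weightSpace.1 hw).1]
    simp
  | succ k ih =>
    rw [pow_succ', Module.End.mul_apply, T.ef, ih, map_smul,
      (mem_weightSpace.1 (T.f_pow_mem hw (k + 1))).1, ← Module.End.mul_apply, ← pow_succ']
    push_cast
    module

/-- The vector is annihilated by `e` but has weight -n - 2 < 0, where `e` is injective. -/
theorem f_pow_eq_zero [FiniteDimensional ℂ V] (T : GL2Action e f h c)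
    (hw : w ∈ weightSpace h c n q) (h0 : e w = 0) :
    (f ^ (n + 1)) w = 0 := by
  refine T.eq_zero_of_e_eq_zero ?_ (T.f_pow_mem hw (n + 1)) ?_
  · push_cast; omega
  · rw [T.e_f_pow hw h0]; simp

theorem f_pow_ne_zero (T : GL2Action e f h c) (hw : w ∈ weightSpace h c n q) (h0 : e w = 0)
    (hne : w ≠ 0) (k : ℕ) (hk : k ≤ n) : (f ^ k) w ≠ 0 := by
  induction k with
  | zero => simpa using hne
  | succ k ih =>
    intro hz
    have h1 := T.e_f_pow hw h0 k
    rw [hz, map_zero, eq_comm, smul_eq_zero] at h1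
    refine h1.elim (fun h2 => ?_) (ih (by omega))
    have hk' : (n : ℂ) - k ≠ 0 := by
      rw [sub_ne_zero]; exact_mod_cast (by omega : n ≠ k)
    have hk1 : (k : ℂ) + 1 ≠ 0 := by exact_mod_cast (Nat.succ_ne_zero k)
    exact mul_ne_zero hk1 hk' h2

/-- The submodule spanned by the vectors `f ^ k w`. -/
def string (f : Module.End ℂ V) (n : ℕ) (w : V) : Submodule ℂ V :=
  Submodule.span ℂ (Set.range fun k : Fin (n + 1) => (f ^ (k : ℕ)) w)

theorem f_pow_mem_string (f : Module.End ℂ V) (w : V) {n k : ℕ} (hk : k ≤ n) :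
    (f ^ k) w ∈ string f n w :=
  Submodule.subset_span ⟨⟨k, by omega⟩, rfl⟩

theorem self_mem_string (f : Module.End ℂ V) (w : V) (n : ℕ) : w ∈ string f n w := by
  simpa using f_pow_mem_string f w (Nat.zero_le n)

theorem string_le {W : Submodule ℂ V} (hf : ∀ x ∈ W, f x ∈ W) (hw : w ∈ W) :
    string f n w ≤ W := by
  refine Submodule.span_le.2 ?_
  rintro _ ⟨k, rfl⟩
  change (f ^ (k : ℕ)) w ∈ W
  induction (k : ℕ) with
  | zero => simpa using hw
  | succ k ih => rw [pow_succ', Module.End.mul_apply]; exact hf _ ih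

theorem string_induction {P : Submodule ℂ V} (hP : ∀ k ≤ n, (f ^ k) w ∈ P) :
    string f n w ≤ P := by
  refine Submodule.span_le.2 ?_
  rintro _ ⟨k, rfl⟩
  exact hP k (by omega)

theorem string_stable [FiniteDimensional ℂ V] (T : GL2Action e f h c)
    (hw : w ∈ weightSpace h c n q) (h0 : e w = 0) :
    ∀ x ∈ string f n w, e x ∈ string f n w ∧ f x ∈ string f n w ∧ h x ∈ string f n w ∧
      c x ∈ string f n w := by
  intro x hx
  have hall : string f n w ≤ (string f n w).comap e ⊓ (string f n w).comap f ⊓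
      ((string f n w).comap h ⊓ (string f n w).comap c) := by
    refine string_induction fun k hk => ?_
    have hmem := f_pow_mem_string f w hk
    have hwt := mem_weightSpace.1 (T.f_pow_mem hw k)
    refine ⟨⟨?_, ?_⟩, ?_, ?_⟩
    · rw [SetLike.mem_coe, Submodule.mem_comap]
      rcases k with _ | k
      · simp [h0]
      · rw [T.e_f_pow hw h0]
        exact Submodule.smul_mem _ _ (f_pow_mem_string f w (by omega))
    · rw [SetLike.mem_coe, Submodule.mem_comap, ← Module.End.mul_apply, ← pow_succ']
      rcases hk.lt_or_eq with hlt | rfl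
      · exact f_pow_mem_string f w hlt
      · rw [T.f_pow_eq_zero hw h0]; exact Submodule.zero_mem _
    · rw [SetLike.mem_coe, Submodule.mem_comap, hwt.1]; exact Submodule.smul_mem _ _ hmem
    · rw [SetLike.mem_coe, Submodule.mem_comap, hwt.2]; exact Submodule.smul_mem _ _ hmem
  obtain ⟨⟨h1, h2⟩, h3, h4⟩ := hall hx
  exact ⟨h1, h2, h3, h4⟩

theorem linearIndependent_f_pow (T : GL2Action e f h c) (hw : w ∈ weightSpace h c n q)
    (h0 : e w = 0) (hne : w ≠ 0) :
    LinearIndependent ℂ fun k : Fin (n + 1) => (f ^ (k : ℕ)) w := by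
  refine Module.End.eigenvectors_linearIndependent' h
    (fun k : Fin (n + 1) => ((n - 2 * k : ℤ) : ℂ)) ?_ _ fun k =>
    ⟨Module.End.mem_eigenspace_iff.2 (mem_weightSpace.1 (T.f_pow_mem hw k)).1,
      T.f_pow_ne_zero hw h0 hne k (by omega)⟩
  intro a b hab
  have : (n - 2 * (a : ℕ) : ℤ) = n - 2 * (b : ℕ) := Int.cast_injective hab
  exact Fin.ext (by omega)

theorem finrank_string (T : GL2Action e f h c) (hw : w ∈ weightSpace h c n q) (h0 : e w = 0)
    (hne : w ≠ 0) : Module.finrank ℂ (string f n w) = n + 1 := by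
  rw [string, finrank_span_eq_card (T.linearIndependent_f_pow hw h0 hne), Fintype.card_fin]

/-- The primitive vectors in `string f n w` are the multiples of `w`. -/
theorem exists_smul_of_mem_string (T : GL2Action e f h c) (hw : w ∈ weightSpace h c n q)
    (h0 : e w = 0) (hne : w ≠ 0) {x : V} (hx : x ∈ string f n w) (hex : e x = 0) :
    ∃ a : ℂ, x = a • w := by
  obtain ⟨a, rfl⟩ := (Submodule.mem_span_range_iff_exists_fun ℂ).1 hx
  refine ⟨a 0, ?_⟩
  have hli := T.linearIndependent_f_pow hw h0 hne
  -- Applying `e` kills the k = 0 term and shifts the others down with nonzero factors, so linear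
  -- independence forces all remaining coefficients to vanish.
  rw [Fin.sum_univ_succ, map_add, map_sum] at hex
  simp only [Fin.val_zero, pow_zero, Module.End.one_apply, map_smul, h0, smul_zero, zero_add,
    Fin.val_succ, T.e_f_pow hw h0, smul_smul] at hex
  have hli' : LinearIndependent ℂ fun k : Fin n => (f ^ (k : ℕ)) w :=
    hli.comp Fin.castSucc (Fin.castSucc_injective n)
  have hz := Fintype.linearIndependent_iff.1 hli' _ hex
  rw [Fin.sum_univ_succ]
  simp only [Fin.val_zero, pow_zero, Module.End.one_apply]
  rw [add_eq_left]
  refine Finset.sum_eq_zero fun k _ => ?_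
  have hk := hz k
  have hk' : (n : ℂ) - (k : ℕ) ≠ 0 := by
    rw [sub_ne_zero]; exact_mod_cast (by omega : n ≠ k)
  have hk1 : ((k : ℕ) : ℂ) + 1 ≠ 0 := by exact_mod_cast (Nat.succ_ne_zero k)
  rw [(mul_eq_zero.1 hk).resolve_right (mul_ne_zero hk1 hk'), zero_smul]

/-- `string f n w` is irreducible. -/
theorem string_minimal (T : GL2Action e f h c) (hw : w ∈ weightSpace h c n q) (h0 : e w = 0)
    (hne : w ≠ 0) (W : Submodule ℂ V) (hW : W ≤ string f n w) (he : ∀ x ∈ W, e x ∈ W)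
    (hf : ∀ x ∈ W, f x ∈ W) : W = ⊥ ∨ W = string f n w := by
  classical
  by_cases hbot : W = ⊥
  · exact Or.inl hbot
  refine Or.inr (le_antisymm hW ?_)
  obtain ⟨x, hxW, hx0⟩ := W.ne_bot_iff.1 hbot
  have hnil : ∀ y ∈ string f n w, (e ^ (n + 1)) y = 0 := by
    have : string f n w ≤ LinearMap.ker (e ^ (n + 1)) := by
      refine string_induction fun k hk => ?_
      have hk0 : (e ^ (k + 1)) ((f ^ k) w) = 0 := by
        clear hk
        induction k with
        | zero => simpa using h0
        | succ k ih => rw [pow_succ, Module.End.mul_apply, T.e_f_pow hw h0, map_smul, ih, smul_zero]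
      rw [LinearMap.mem_ker, show n + 1 = (n - k) + (k + 1) by omega, pow_add,
        Module.End.mul_apply, hk0, map_zero]
    exact this
  -- Raise a nonzero vector of `W` as often as possible: the last nonzero vector e^s x is primitive,
  -- hence a multiple of `w`, and `w` regenerates the whole string.
  have hex : ∃ r, (e ^ r) x = 0 := ⟨n + 1, hnil x (hW hxW)⟩
  have hr := Nat.find_spec hex
  set r := Nat.find hex with hrdef
  have hr0 : r ≠ 0 := by
    intro hr0
    rw [hr0] at hr
    exact hx0 (by simpa using hr)
  obtain ⟨s, hs⟩ := Nat.exists_eq_succ_of_ne_zero hr0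
  have hpowW : ∀ k, (e ^ k) x ∈ W := by
    intro k
    induction k with
    | zero => simpa using hxW
    | succ k ih => rw [pow_succ', Module.End.mul_apply]; exact he _ ih
  have hsne : (e ^ s) x ≠ 0 := Nat.find_min hex (by omega)
  rw [hs, Nat.succ_eq_add_one, pow_succ', Module.End.mul_apply] at hr
  obtain ⟨a, ha⟩ := T.exists_smul_of_mem_string hw h0 hne (hW (hpowW s)) hr
  have ha0 : a ≠ 0 := by
    rintro rfl
    exact hsne (by simpa using ha)
  refine string_le hf ?_
  have := W.smul_mem a⁻¹ (hpowW s)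
  rwa [ha, smul_smul, inv_mul_cancel₀ ha0, one_smul] at this

end Primitive

end GL2Action

end GL2

/-! ### Highest weight modules of gl(3) and branching to gl(2) -/

section GL3

variable {V : Type*} [AddCommGroup V] [Module ℂ V]

/-- An eigenvector in the span of eigenvectors lies in the span of those with its eigenvalue. -/
theorem mem_span_of_mem_eigenspace {ι : Type*} (D : Module.End ℂ V) (g : ι → V) (d : ι → ℂ)
    (hg : ∀ i, D (g i) = d i • g i) {μ : ℂ} {w : V} (hw : D w = μ • w)
    (hspan : w ∈ Submodule.span ℂ (Set.range g)) :
    w ∈ Submodule.span ℂ (g '' {i | d i = μ}) := by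
  have hsplit : Set.range g = g '' {i | d i = μ} ∪ g '' {i | d i ≠ μ} := by
    rw [← Set.image_union, ← Set.image_univ]
    congr 1
    ext i
    simp [em]
  rw [hsplit, Submodule.span_union, Submodule.mem_sup] at hspan
  obtain ⟨y, hy, z, hz, rfl⟩ := hspan
  have hyE : Submodule.span ℂ (g '' {i | d i = μ}) ≤ Module.End.eigenspace D μ := by
    refine Submodule.span_le.2 ?_
    rintro _ ⟨i, hi, rfl⟩
    exact Module.End.mem_eigenspace_iff.2 (by rw [hg, show d i = μ from hi])
  have hzE : Submodule.span ℂ (g '' {i | d i ≠ μ}) ≤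
      ⨆ ν, ⨆ _ : ν ≠ μ, Module.End.eigenspace D ν := by
    refine Submodule.span_le.2 ?_
    rintro _ ⟨i, hi, rfl⟩
    exact Submodule.mem_iSup_of_mem (d i) (Submodule.mem_iSup_of_mem hi
      (Module.End.mem_eigenspace_iff.2 (hg i)))
  have hz2 : z ∈ Module.End.eigenspace D μ := by
    have := Submodule.sub_mem _ (Module.End.mem_eigenspace_iff.2 hw) (hyE hy)
    rwa [add_sub_cancel_left] at this
  -- The remainder `z` lies both in the eigenspace of μ and in the sum of the other eigenspaces,
  -- which are independent.
  have hz0 := Submodule.disjoint_def.1 ((Module.End.eigenspaces_iSupIndep D) μ) z hz2 (hzE hz)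
  rwa [hz0, add_zero]

/-- Operators satisfying the relations of the matrix units of `gl(3)`, with trivial trace. -/
structure GL3Action (E : Fin 3 → Fin 3 → Module.End ℂ V) : Prop where
  comm : ∀ i j k l x, E i j (E k l x) =
    E k l (E i j x) + (if j = k then E i l x else 0) - (if l = i then E k j x else 0)
  trace : ∀ x, E 0 0 x + E 1 1 x + E 2 2 x = 0

namespace GL3Action

variable {E : Fin 3 → Fin 3 → Module.End ℂ V}

/-- The factor -3 makes the central element act as 3Y, which takes integer values on the weight
vectors of a highest weight module. -/
theorem gl2 (T : GL3Action E) :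
    GL2Action (E 0 1) (E 1 0) (E 0 0 - E 1 1) ((-3 : ℂ) • E 2 2) where
  ef x := by rw [T.comm]; simp; abel
  he x := by
    have h1 := T.comm 0 0 0 1 x
    have h2 := T.comm 1 1 0 1 x
    simp at h1 h2
    simp [h1, h2]; module
  hf x := by
    have h1 := T.comm 0 0 1 0 x
    have h2 := T.comm 1 1 1 0 x
    simp at h1 h2
    simp [h1, h2]; module
  ce x := by simp [T.comm 2 2 0 1 x]
  cf x := by simp [T.comm 2 2 1 0 x]
  ch x := by simp [T.comm 2 2 0 0 x, T.comm 2 2 1 1 x, smul_sub]; abel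

/-- The quadratic Casimir operator. -/
def casimirOp (E : Fin 3 → Fin 3 → Module.End ℂ V) : Module.End ℂ V :=
  ∑ i, ∑ j, E i j * E j i

/-- Moving E_kl past E_ij E_ji produces four correction terms; summed over i and j they cancel in
pairs. -/
theorem commute_casimirOp (T : GL3Action E) (k l : Fin 3) (x : V) :
    casimirOp E (E k l x) = E k l (casimirOp E x) := by
  have hterm : ∀ i j, E k l (E i j (E j i x)) = E i j (E j i (E k l x)) +
      ((if l = i then E k j (E j i x) else 0) - (if j = k then E i l (E j i x) else 0)) +
      ((if l = j then E i j (E k i x) else 0) - (if i = k then E i j (E j l x) else 0)) := by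
    intro i j
    rw [T.comm k l i j, T.comm k l j i x, map_sub, map_add]
    have e1 : E i j (if l = j then E k i x else 0) = if l = j then E i j (E k i x) else 0 := by
      split_ifs <;> simp
    have e2 : E i j (if i = k then E j l x else 0) = if i = k then E i j (E j l x) else 0 := by
      split_ifs <;> simp
    rw [e1, e2]
    abel
  simp only [casimirOp, LinearMap.sum_apply, Module.End.mul_apply, map_sum, hterm,
    Finset.sum_add_distrib, Finset.sum_sub_distrib, Finset.sum_ite_eq, Finset.sum_ite_eq',
    Finset.sum_ite_irrel, Finset.sum_const_zero, Finset.mem_univ, if_true]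
  abel

variable {v : V} {o₁ o₂ : ℕ}

/-- Highest weight vectors with Dynkin labels `o₁, o₂`. -/
structure IsHighestWeight (E : Fin 3 → Fin 3 → Module.End ℂ V) (o₁ o₂ : ℕ) (v : V) : Prop where
  e01 : E 0 1 v = 0
  e12 : E 1 2 v = 0
  h1 : E 0 0 v - E 1 1 v = (o₁ : ℂ) • v
  h2 : E 1 1 v - E 2 2 v = (o₂ : ℂ) • v

namespace IsHighestWeight

theorem e02 (T : GL3Action E) (H : IsHighestWeight E o₁ o₂ v) : E 0 2 v = 0 := by
  have := T.comm 0 1 1 2 v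
  simpa [H.e12, H.e01] using this.symm

theorem e11 (T : GL3Action E) (H : IsHighestWeight E o₁ o₂ v) :
    E 1 1 v = (((o₂ : ℂ) - o₁) / 3) • v := by
  have h0 := T.trace v
  have h22 : E 2 2 v = E 1 1 v - (o₂ : ℂ) • v := by rw [← H.h2, sub_sub_cancel]
  rw [eq_add_of_sub_eq H.h1, h22] at h0
  have e : E 1 1 v = (1 / 3 : ℂ) • ((o₁ : ℂ) • v + E 1 1 v + E 1 1 v + (E 1 1 v - (o₂ : ℂ) • v)) +
      (((o₂ : ℂ) - o₁) / 3) • v := by module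
  rw [e, h0, smul_zero, zero_add]

theorem e00 (T : GL3Action E) (H : IsHighestWeight E o₁ o₂ v) :
    E 0 0 v = ((2 * (o₁ : ℂ) + o₂) / 3) • v := by
  rw [eq_add_of_sub_eq H.h1, H.e11 T]; module

theorem e22 (T : GL3Action E) (H : IsHighestWeight E o₁ o₂ v) :
    E 2 2 v = (-((o₁ : ℂ) + 2 * o₂) / 3) • v := by
  have := H.h2
  rw [H.e11 T] at this
  rw [← sub_sub_cancel ((((o₂ : ℂ) - o₁) / 3) • v) (E 2 2 v), this]; module

/-- For i < j the raising operator E_ij kills `v`, so E_ij E_ji acts on it as E_ii - E_jj, and only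
diagonal entries remain. -/
theorem casimirOp_apply (T : GL3Action E) (H : IsHighestWeight E o₁ o₂ v) :
    casimirOp E v = (2 / 3 * ((o₁ : ℂ) ^ 2 + o₁ * o₂ + o₂ ^ 2) + 2 * (o₁ + o₂)) • v := by
  have h01 := T.comm 0 1 1 0 v
  have h02 := T.comm 0 2 2 0 v
  have h12 := T.comm 1 2 2 1 v
  simp [H.e01, H.e12, H.e02 T, H.e00 T, H.e11 T, H.e22 T] at h01 h02 h12
  simp [casimirOp, Fin.sum_univ_three, H.e01, H.e12, H.e02 T, H.e00 T, H.e11 T, H.e22 T, h01, h02,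
    h12]
  module

end IsHighestWeight

/-- The Poincaré–Birkhoff–Witt monomials applied to `v`. -/
def monomial (E : Fin 3 → Fin 3 → Module.End ℂ V) (v : V) (p : ℕ × ℕ × ℕ) : V :=
  (E 1 0 ^ p.1) ((E 2 1 ^ p.2.1) ((E 2 0 ^ p.2.2) v))

theorem commute_20_10 (T : GL3Action E) : Commute (E 2 0) (E 1 0) :=
  LinearMap.ext fun x => by simp [T.comm 2 0 1 0 x]

theorem commute_20_21 (T : GL3Action E) : Commute (E 2 0) (E 2 1) :=
  LinearMap.ext fun x => by simp [T.comm 2 0 2 1 x]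

theorem e10_monomial (k a b : ℕ) : E 1 0 (monomial E v (k, a, b)) = monomial E v (k + 1, a, b) := by
  simp [monomial, pow_succ']

theorem e20_monomial (T : GL3Action E) (k a b : ℕ) :
    E 2 0 (monomial E v (k, a, b)) = monomial E v (k, a, b + 1) := by
  have h1 := T.commute_20_10.pow_right k
  have h2 := T.commute_20_21.pow_right a
  simp only [monomial]
  rw [← Module.End.mul_apply, h1.eq, Module.End.mul_apply, ← Module.End.mul_apply (E 2 0), h2.eq,
    Module.End.mul_apply, pow_succ' (E 2 0), Module.End.mul_apply]

/-- The commutator [E₂₁, E₁₀] = E₂₀ commutes with E₁₀, so each of the k + 1 factors contributes the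
same correction. This is the only reordering the monomials need under lowering. -/
theorem e21_pow (T : GL3Action E) (k : ℕ) (y : V) :
    E 2 1 ((E 1 0 ^ (k + 1)) y) =
      (E 1 0 ^ (k + 1)) (E 2 1 y) + ((k + 1 : ℕ) : ℂ) • (E 1 0 ^ k) (E 2 0 y) := by
  have hcomm : ∀ (k : ℕ) (y : V), E 2 0 ((E 1 0 ^ k) y) = (E 1 0 ^ k) (E 2 0 y) := fun k y => by
    rw [← Module.End.mul_apply, (T.commute_20_10.pow_right k).eq, Module.End.mul_apply]
  have hb : ∀ y, E 2 1 (E 1 0 y) = E 1 0 (E 2 1 y) + E 2 0 y := fun y => by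
    simp [T.comm 2 1 1 0 y]
  induction k with
  | zero => simp [hb]
  | succ k ih =>
    have hp : ∀ (r : ℕ) (z : V), E 1 0 ((E 1 0 ^ r) z) = (E 1 0 ^ (r + 1)) z := fun r z => by
      rw [pow_succ', Module.End.mul_apply]
    rw [← hp, hb, ih, hcomm, map_add, map_smul, hp, hp]
    push_cast
    module

theorem e21_monomial_mem (T : GL3Action E) (p : ℕ × ℕ × ℕ) :
    E 2 1 (monomial E v p) ∈ Submodule.span ℂ (Set.range (monomial E v)) := by
  obtain ⟨k, a, b⟩ := p
  rcases k with _ | k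
  · exact Submodule.subset_span ⟨(0, a + 1, b), by simp [monomial, pow_succ']⟩
  · simp only [monomial]
    rw [T.e21_pow]
    refine Submodule.add_mem _ (Submodule.subset_span ⟨(k + 1, a + 1, b), ?_⟩)
      (Submodule.smul_mem _ _ (Submodule.subset_span ⟨(k, a, b + 1), ?_⟩))
    · simp [monomial, pow_succ']
    · have := T.e20_monomial (v := v) 0 a b
      simp only [monomial, pow_zero, Module.End.one_apply] at this
      simp only [monomial, this]

theorem lower_mem (T : GL3Action E) {k l : Fin 3} (hkl : l < k) {x : V}
    (hx : x ∈ Submodule.span ℂ (Set.range (monomial E v))) :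
    E k l x ∈ Submodule.span ℂ (Set.range (monomial E v)) := by
  suffices h : Submodule.span ℂ (Set.range (monomial E v)) ≤
      (Submodule.span ℂ (Set.range (monomial E v))).comap (E k l) from h hx
  refine Submodule.span_le.2 ?_
  rintro _ ⟨⟨r, a, b⟩, rfl⟩
  rw [SetLike.mem_coe, Submodule.mem_comap]
  have hcases : (k = 1 ∧ l = 0) ∨ (k = 2 ∧ l = 0) ∨ (k = 2 ∧ l = 1) := by
    revert k l; decide
  rcases hcases with ⟨rfl, rfl⟩ | ⟨rfl, rfl⟩ | ⟨rfl, rfl⟩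
  · rw [e10_monomial]; exact Submodule.subset_span ⟨_, rfl⟩
  · rw [T.e20_monomial]; exact Submodule.subset_span ⟨_, rfl⟩
  · exact T.e21_monomial_mem _

/-- An irreducible module is spanned by the monomials applied to a highest weight vector. -/
theorem span_monomial (T : GL3Action E) (H : IsHighestWeight E o₁ o₂ v) (hv : v ≠ 0)
    (hirr : ∀ W : Submodule ℂ V, (∀ i j, ∀ x ∈ W, E i j x ∈ W) → W = ⊥ ∨ W = ⊤) :
    Submodule.span ℂ (Set.range (monomial E v)) = ⊤ := by
  set K := Submodule.span ℂ (Set.range (monomial E v)) with hK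
  have hvK : v ∈ K := Submodule.subset_span ⟨(0, 0, 0), by simp [monomial]⟩
  -- `S` consists of the vectors of `K` that every E_ij sends into `K`. It contains `v` and, by the
  -- commutation relations, is stable under lowering, so it contains all of `K`. Thus `K` is stable
  -- without computing raising operators on monomials.
  let S : Submodule ℂ V := K ⊓ ⨅ i, ⨅ j, K.comap (E i j)
  have hS : ∀ x, x ∈ S ↔ x ∈ K ∧ ∀ i j, E i j x ∈ K := fun x => by
    simp [S, Submodule.mem_iInf]
  have hvS : v ∈ S := by
    rw [hS]
    refine ⟨hvK, fun i j => ?_⟩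
    rcases lt_trichotomy i j with hij | rfl | hij
    · have hcases : (i = 0 ∧ j = 1) ∨ (i = 0 ∧ j = 2) ∨ (i = 1 ∧ j = 2) := by
        revert i j; decide
      rcases hcases with ⟨rfl, rfl⟩ | ⟨rfl, rfl⟩ | ⟨rfl, rfl⟩
      · rw [H.e01]; exact K.zero_mem
      · rw [H.e02 T]; exact K.zero_mem
      · rw [H.e12]; exact K.zero_mem
    · fin_cases i
      · exact (H.e00 T) ▸ K.smul_mem _ hvK
      · exact (H.e11 T) ▸ K.smul_mem _ hvK
      · exact (H.e22 T) ▸ K.smul_mem _ hvK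
    · exact T.lower_mem hij hvK
  have hSlow : ∀ k l : Fin 3, l < k → ∀ x ∈ S, E k l x ∈ S := by
    intro k l hkl x hx
    rw [hS] at hx ⊢
    refine ⟨hx.2 k l, fun i j => ?_⟩
    rw [T.comm]
    refine K.sub_mem (K.add_mem (T.lower_mem hkl (hx.2 i j)) ?_) ?_
    · split_ifs
      · exact hx.2 _ _
      · exact K.zero_mem
    · split_ifs
      · exact hx.2 _ _
      · exact K.zero_mem
  have hpow : ∀ k l : Fin 3, l < k → ∀ (r : ℕ), ∀ x ∈ S, (E k l ^ r) x ∈ S := by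
    intro k l hkl r x hx
    induction r with
    | zero => simpa using hx
    | succ r ih => rw [pow_succ', Module.End.mul_apply]; exact hSlow k l hkl _ ih
  have hKS : K ≤ S := by
    refine Submodule.span_le.2 ?_
    rintro _ ⟨p, rfl⟩
    exact hpow 1 0 (by decide) _ _ (hpow 2 1 (by decide) _ _ (hpow 2 0 (by decide) _ _ hvS))
  refine (hirr K fun i j x hx => ((hS x).1 (hKS hx)).2 i j).resolve_left fun hbot => hv ?_
  rwa [hbot, Submodule.mem_bot] at hvK

/-- On the pair (2I₃, 3Y) the operators E₁₀, E₂₁, E₂₀ act by the shifts (-2, 0), (1, -3), (-1, -3).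
When k = 0 the weight determines both a - b and a + b, hence the monomial; multiplicity freeness
rests on this. -/
theorem monomial_mem_weightSpace (T : GL3Action E) (H : IsHighestWeight E o₁ o₂ v)
    (p : ℕ × ℕ × ℕ) :
    monomial E v p ∈ weightSpace (E 0 0 - E 1 1) ((-3 : ℂ) • E 2 2)
      (o₁ + p.2.1 - p.2.2 - 2 * p.1) (o₁ + 2 * o₂ - 3 * (p.2.1 + p.2.2)) := by
  obtain ⟨k, a, b⟩ := p
  have hv : v ∈ weightSpace (E 0 0 - E 1 1) ((-3 : ℂ) • E 2 2) o₁ (o₁ + 2 * o₂) := by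
    rw [mem_weightSpace]
    refine ⟨by simpa using H.h1, ?_⟩
    rw [LinearMap.smul_apply, H.e22 T]; push_cast; module
  have h20 : ∀ j q x, x ∈ weightSpace (E 0 0 - E 1 1) ((-3 : ℂ) • E 2 2) j q →
      E 2 0 x ∈ weightSpace (E 0 0 - E 1 1) ((-3 : ℂ) • E 2 2) (j - 1) (q - 3) := by
    intro j q x hx
    rw [mem_weightSpace] at hx ⊢
    have h0 := T.comm 0 0 2 0 x
    have h1 := T.comm 1 1 2 0 x
    have h2 := T.comm 2 2 2 0 x
    simp at h0 h1 h2
    simp only [LinearMap.sub_apply, LinearMap.smul_apply] at hx ⊢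
    refine ⟨?_, ?_⟩
    · rw [h0, h1, sub_right_comm, ← map_sub, hx.1, map_smul]; push_cast; module
    · rw [h2, smul_add, ← map_smul, hx.2, map_smul]; push_cast; module
  have h21 : ∀ j q x, x ∈ weightSpace (E 0 0 - E 1 1) ((-3 : ℂ) • E 2 2) j q →
      E 2 1 x ∈ weightSpace (E 0 0 - E 1 1) ((-3 : ℂ) • E 2 2) (j + 1) (q - 3) := by
    intro j q x hx
    rw [mem_weightSpace] at hx ⊢
    have h0 := T.comm 0 0 2 1 x
    have h1 := T.comm 1 1 2 1 x
    have h2 := T.comm 2 2 2 1 x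
    simp at h0 h1 h2
    simp only [LinearMap.sub_apply, LinearMap.smul_apply] at hx ⊢
    refine ⟨?_, ?_⟩
    · rw [h0, h1, sub_sub_eq_add_sub, add_sub_right_comm, ← map_sub, hx.1, map_smul]
      push_cast; module
    · rw [h2, smul_add, ← map_smul, hx.2, map_smul]; push_cast; module
  have hb : (E 2 0 ^ b) v ∈ weightSpace (E 0 0 - E 1 1) ((-3 : ℂ) • E 2 2) (o₁ - b)
      (o₁ + 2 * o₂ - 3 * b) := by
    induction b with
    | zero => simpa using hv
    | succ b ih =>
      rw [pow_succ', Module.End.mul_apply]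
      convert h20 _ _ _ ih using 1
      push_cast; ring_nf
  have ha : (E 2 1 ^ a) ((E 2 0 ^ b) v) ∈ weightSpace (E 0 0 - E 1 1) ((-3 : ℂ) • E 2 2)
      (o₁ + a - b) (o₁ + 2 * o₂ - 3 * (a + b)) := by
    induction a with
    | zero => simpa using hb
    | succ a ih =>
      rw [pow_succ', Module.End.mul_apply]
      convert h21 _ _ _ ih using 1
      push_cast; ring_nf
  simp only [monomial]
  induction k with
  | zero => simpa using ha
  | succ k ih =>
    rw [pow_succ', Module.End.mul_apply]
    convert T.gl2.f_mem ih using 1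
    push_cast; ring_nf

theorem iSup_weightSpace (T : GL3Action E) (H : IsHighestWeight E o₁ o₂ v)
    (hspan : Submodule.span ℂ (Set.range (monomial E v)) = ⊤) :
    ⨆ j, ⨆ q, weightSpace (E 0 0 - E 1 1) ((-3 : ℂ) • E 2 2) j q = ⊤ := by
  rw [eq_top_iff, ← hspan]
  refine Submodule.span_le.2 ?_
  rintro _ ⟨p, rfl⟩
  exact Submodule.mem_iSup_of_mem _ (Submodule.mem_iSup_of_mem _ (T.monomial_mem_weightSpace H p))

/-- Branching from `gl(3)` to `gl(2)` is multiplicity free: the primitive vectors of a given weight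
are proportional. -/
theorem exists_smul_of_primitive [FiniteDimensional ℂ V] (T : GL3Action E)
    (H : IsHighestWeight E o₁ o₂ v)
    (hspan : Submodule.span ℂ (Set.range (monomial E v)) = ⊤) {n : ℕ} {q : ℤ} {w₁ w₂ : V}
    (h₁ : w₁ ∈ weightSpace (E 0 0 - E 1 1) ((-3 : ℂ) • E 2 2) n q)
    (h₂ : w₂ ∈ weightSpace (E 0 0 - E 1 1) ((-3 : ℂ) • E 2 2) n q)
    (he₁ : E 0 1 w₁ = 0) (he₂ : E 0 1 w₂ = 0) (hne : w₂ ≠ 0) : ∃ s : ℂ, w₁ = s • w₂ := by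
  -- `x₀` is the unique monomial of this weight without a factor E₁₀, or 0 when none exists.
  obtain ⟨x₀, hx₀⟩ : ∃ x₀ : V, ∀ a b : ℕ, (o₁ + a - b : ℤ) = n →
      (o₁ + 2 * o₂ - 3 * (a + b) : ℤ) = q → monomial E v (0, a, b) = x₀ := by
    by_cases hex : ∃ a b : ℕ, (o₁ + a - b : ℤ) = n ∧ (o₁ + 2 * o₂ - 3 * (a + b) : ℤ) = q
    · obtain ⟨a, b, ha, hb⟩ := hex
      refine ⟨monomial E v (0, a, b), fun a' b' ha' hb' => ?_⟩
      rw [show a' = a by omega, show b' = b by omega]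
    · exact ⟨0, fun a b ha hb => (hex ⟨a, b, ha, hb⟩).elim⟩
  have key : ∀ w ∈ weightSpace (E 0 0 - E 1 1) ((-3 : ℂ) • E 2 2) n q, ∃ s : ℂ,
      ∃ y ∈ weightSpace (E 0 0 - E 1 1) ((-3 : ℂ) • E 2 2) (n + 2) q, w = s • x₀ + E 1 0 y := by
    intro w hw
    -- The two weights are real, so the single operator h + i c, with eigenvalue j + iq, separates
    -- the pairs (j, q).
    have hD : ∀ {j q : ℤ} {x : V}, x ∈ weightSpace (E 0 0 - E 1 1) ((-3 : ℂ) • E 2 2) j q →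
        ((E 0 0 - E 1 1) + Complex.I • ((-3 : ℂ) • E 2 2)) x = (j + Complex.I * q : ℂ) • x := by
      intro j q x hx
      rw [mem_weightSpace] at hx
      rw [LinearMap.add_apply, LinearMap.smul_apply _ ((-3 : ℂ) • E 2 2), hx.1, hx.2, smul_smul,
        ← add_smul]
    have hmem := mem_span_of_mem_eigenspace _ (monomial E v) _
      (fun p => hD (T.monomial_mem_weightSpace H p)) (hD hw) (hspan ▸ Submodule.mem_top)
    have hmem' : w ∈ Submodule.span ℂ {x₀} ⊔
        (weightSpace (E 0 0 - E 1 1) ((-3 : ℂ) • E 2 2) (n + 2) q).map (E 1 0) := by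
      refine Submodule.span_le.2 ?_ hmem
      rintro _ ⟨⟨k, a, b⟩, hp, rfl⟩
      have hre := congrArg Complex.re hp
      have him := congrArg Complex.im hp
      simp at hre him
      have hre' : (o₁ + a - b - 2 * k : ℤ) = n := by exact_mod_cast hre
      have him' : (o₁ + 2 * o₂ - 3 * (a + b) : ℤ) = q := by exact_mod_cast him
      rcases k with _ | k
      · refine Submodule.mem_sup_left ?_
        rw [hx₀ a b (by simpa using hre') him']
        exact Submodule.mem_span_singleton_self _
      · refine Submodule.mem_sup_right ⟨monomial E v (k, a, b), ?_, e10_monomial k a b⟩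
        have e₁ : (o₁ + a - b - 2 * k : ℤ) = n + 2 := by push_cast at hre'; omega
        exact e₁ ▸ him' ▸ T.monomial_mem_weightSpace H (k, a, b)
    obtain ⟨x, hx, z, ⟨y, hy, rfl⟩, rfl⟩ := Submodule.mem_sup.1 hmem'
    obtain ⟨s, rfl⟩ := Submodule.mem_span_singleton.1 hx
    exact ⟨s, y, hy, rfl⟩
  obtain ⟨s₁, y₁, hy₁, hw₁⟩ := key w₁ h₁
  obtain ⟨s₂, y₂, hy₂, hw₂⟩ := key w₂ h₂
  -- If the coefficient of `x₀` vanished, `w₂` would be a nonzero primitive vector in the image of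
  -- E₁₀. The combination of `w₁` and `w₂` that eliminates `x₀` is primitive and in that image, so
  -- it vanishes.
  have hs₂ : s₂ ≠ 0 := by
    rintro rfl
    rw [zero_smul, zero_add] at hw₂
    exact hne (hw₂.trans (T.gl2.eq_zero_of_primitive_f hy₂ (by rw [← hw₂, he₂])))
  have hdiff : s₂ • w₁ - s₁ • w₂ = E 1 0 (s₂ • y₁ - s₁ • y₂) := by
    rw [map_sub, map_smul, map_smul]
    nth_rewrite 1 [hw₁]
    nth_rewrite 1 [hw₂]
    module
  have hz := T.gl2.eq_zero_of_primitive_f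
    (Submodule.sub_mem _ (Submodule.smul_mem _ s₂ hy₁) (Submodule.smul_mem _ s₁ hy₂))
    (by rw [← hdiff, map_sub, map_smul, map_smul, he₁, he₂, smul_zero, smul_zero, sub_zero])
  rw [← hdiff, sub_eq_zero] at hz
  refine ⟨s₂⁻¹ * s₁, ?_⟩
  rw [mul_smul, ← hz, smul_smul, inv_mul_cancel₀ hs₂, one_smul]

end GL3Action

end GL3

/-! ### Coordinates, completeness and orthogonality of the Gell-Mann matrices -/

section GellMann

theorem sqrt_three_sq : ((Real.sqrt 3 : ℝ) : ℂ) ^ 2 = 3 := by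
  rw [← Complex.ofReal_pow, Real.sq_sqrt (by norm_num)]; norm_num

theorem sqrt_three_ne_zero : ((Real.sqrt 3 : ℝ) : ℂ) ≠ 0 := by
  intro h
  have := sqrt_three_sq
  rw [h] at this
  norm_num at this

theorem sqrt_three_inv_sq : (((Real.sqrt 3 : ℝ) : ℂ)⁻¹) ^ 2 = 1 / 3 := by
  rw [inv_pow, sqrt_three_sq]; norm_num

/-- The components of an element of `su(3)` in the basis `i λ_a`. -/
noncomputable def gellMannCoord (x : su3) : Fin 8 → ℝ :=
  ![(x.1 0 1).im, (x.1 0 1).re, ((x.1 0 0).im - (x.1 1 1).im) / 2, (x.1 0 2).im, (x.1 0 2).re,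
    (x.1 1 2).im, (x.1 1 2).re, -(Real.sqrt 3 / 2 * (x.1 2 2).im)]

theorem su3_conj (x : su3) (i j : Fin 3) : star (x.1 i j) = -x.1 j i := by
  have h : x.1ᴴ = -x.1 := x.2.1
  have := congrFun (congrFun h j) i
  simpa [Matrix.conjTranspose_apply] using this

theorem sum_gellMannCoord (x : su3) : ∑ a, gellMannCoord x a • iGellMann a = x := by
  apply Subtype.ext
  have h3 := sqrt_three_ne_zero
  have htr : x.1 0 0 + x.1 1 1 + x.1 2 2 = 0 := by
    have h : x.1.trace = 0 := x.2.2
    simpa [Matrix.trace, Fin.sum_univ_three] using h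
  have hre : ∀ i j, (x.1 j i).re = -(x.1 i j).re := fun i j => by
    have := congrArg Complex.re (su3_conj x i j); simp at this; linarith
  have him : ∀ i j, (x.1 j i).im = (x.1 i j).im := fun i j => by
    have := congrArg Complex.im (su3_conj x i j); simp at this; linarith
  have hre0 := hre 0 0
  have hre1 := hre 1 1
  have hre2 := hre 2 2
  have htr' : (x.1 0 0).im + (x.1 1 1).im + (x.1 2 2).im = 0 := by
    simpa using congrArg Complex.im htr
  have hs : Real.sqrt 3 ≠ 0 := by positivity
  rw [AddSubmonoidClass.coe_finsetSum]
  ext i j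
  rw [Matrix.sum_apply, Fin.sum_univ_eight]
  have hcoe : ∀ a, (↑(gellMannCoord x a • iGellMann a) : Matrix (Fin 3) (Fin 3) ℂ) i j =
      gellMannCoord x a • (Complex.I • gellMann a) i j := fun _ => rfl
  simp only [hcoe]
  fin_cases i <;> fin_cases j <;> apply Complex.ext <;> simp [gellMann, gellMannCoord] <;>
    first
    | linarith [hre 0 1, hre 0 2, hre 1 2, him 0 1, him 0 2, him 1 2]
    | (field_simp; rw [Real.sq_sqrt (by norm_num)]; linarith)

/-- Completeness relation of the Gell-Mann matrices. -/
theorem sum_trace_smul_gellMann (M : Matrix (Fin 3) (Fin 3) ℂ) :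
    ∑ a, (1 / 2 * (M * gellMann a).trace) • gellMann a = M - (M.trace / 3) • 1 := by
  ext i j
  rw [Matrix.sum_apply, Fin.sum_univ_eight]
  simp only [Matrix.trace, Matrix.diag, Fin.sum_univ_three, Matrix.mul_apply]
  fin_cases i <;> fin_cases j <;> simp [gellMann] <;> ring_nf <;>
    simp only [Complex.I_sq, sqrt_three_inv_sq] <;> ring

theorem half_trace_gellMann_mul (a b : Fin 8) :
    1 / 2 * (gellMann b * gellMann a).trace = if a = b then 1 else 0 := by
  simp only [Matrix.trace, Matrix.diag, Fin.sum_univ_three, Matrix.mul_apply]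
  fin_cases a <;> fin_cases b <;> simp [gellMann] <;> ring_nf
  rw [sqrt_three_inv_sq]; norm_num

end GellMann

/-! ### From a representation of su(3) to operators for the matrix units -/

section Bridge

attribute [local instance 100] LieRing.ofAssociativeRing

variable {V : Type*} [NormedAddCommGroup V] [NormedSpace ℂ V]

/-- The operators `L_a` of a representation of `su(3)`. -/
noncomputable def gellMannOp (ρ : su3 →ₗ[ℝ] (V →L[ℂ] V)) (a : Fin 8) : Module.End ℂ V :=
  (-Complex.I) • ((ρ (iGellMann a) : V →L[ℂ] V) : V →ₗ[ℂ] V)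

/-- The complexification of a representation of `su(3)`, extended by `0` to the scalars. -/
noncomputable def complexify (ρ : su3 →ₗ[ℝ] (V →L[ℂ] V)) :
    Matrix (Fin 3) (Fin 3) ℂ →ₗ[ℂ] Module.End ℂ V where
  toFun M := ∑ a, (1 / 2 * (M * gellMann a).trace) • gellMannOp ρ a
  map_add' M N := by
    simp only [Matrix.add_mul, Matrix.trace_add, mul_add, add_smul, Finset.sum_add_distrib]
  map_smul' z M := by
    simp only [Matrix.smul_mul, Matrix.trace_smul, smul_eq_mul, RingHom.id_apply, Finset.smul_sum,
      smul_smul]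
    refine Finset.sum_congr rfl fun a _ => ?_
    congr 1; ring

theorem complexify_gellMann (ρ : su3 →ₗ[ℝ] (V →L[ℂ] V)) (b : Fin 8) :
    complexify ρ (gellMann b) = gellMannOp ρ b := by
  simp only [complexify, LinearMap.coe_mk, AddHom.coe_mk,
    half_trace_gellMann_mul, ite_smul, one_smul, zero_smul,
    Finset.sum_ite_eq', Finset.mem_univ, if_true]

theorem complexify_su3 (ρ : su3 →ₗ[ℝ] (V →L[ℂ] V)) (x : su3) :
    complexify ρ x.1 = ((ρ x : V →L[ℂ] V) : V →ₗ[ℂ] V) := by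
  have h1 : x.1 = ∑ a, ((gellMannCoord x a : ℂ) * Complex.I) • gellMann a := by
    conv_lhs => rw [← sum_gellMannCoord x, AddSubmonoidClass.coe_finsetSum]
    refine Finset.sum_congr rfl fun a _ => ?_
    rw [mul_smul]
    rfl
  rw [h1, map_sum]
  conv_rhs => rw [← sum_gellMannCoord x, map_sum]
  ext v
  simp only [map_smul, complexify_gellMann, gellMannOp, LinearMap.sum_apply, LinearMap.smul_apply,
    ContinuousLinearMap.coe_coe, _root_.sum_apply, _root_.smul_apply, smul_smul]
  refine Finset.sum_congr rfl fun a _ => ?_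
  rw [mul_assoc, mul_neg, Complex.I_mul_I, neg_neg, mul_one, Complex.coe_smul]

theorem complexify_one (ρ : su3 →ₗ[ℝ] (V →L[ℂ] V)) : complexify ρ 1 = 0 := by
  have h : ∀ a, (gellMann a).trace = 0 := by
    intro a
    fin_cases a <;> simp [gellMann, Matrix.trace, Fin.sum_univ_three]
    ring
  simp [complexify, h]

/-- Both sides are bilinear, and scalar parts of `M` and `N` affect neither: they are central, and
`complexify` sees only traces against traceless matrices. It suffices to compare on Gell-Mann
matrices, where it is the bracket relation of ρ. -/
theorem complexify_lie (ρ : su3 →ₗ[ℝ] (V →L[ℂ] V))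
    (hρ : ∀ x y, ρ ⁅x, y⁆ = ρ x * ρ y - ρ y * ρ x) (M N : Matrix (Fin 3) (Fin 3) ℂ) :
    complexify ρ (M * N - N * M) = complexify ρ M * complexify ρ N -
      complexify ρ N * complexify ρ M := by
  have hbasis : ∀ a b, complexify ρ (gellMann a * gellMann b - gellMann b * gellMann a) =
      gellMannOp ρ a * gellMannOp ρ b - gellMannOp ρ b * gellMannOp ρ a := by
    intro a b
    have h1 : gellMann a * gellMann b - gellMann b * gellMann a
        = -(⁅iGellMann a, iGellMann b⁆ : su3).1 := by
      change _ = -((Complex.I • gellMann a) * (Complex.I • gellMann b)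
        - (Complex.I • gellMann b) * (Complex.I • gellMann a))
      simp only [Matrix.smul_mul, Matrix.mul_smul, smul_smul, Complex.I_mul_I]
      simp
      abel
    rw [h1, map_neg, complexify_su3, hρ]
    ext v
    simp [gellMannOp, smul_smul]
    abel
  have hop : ∀ M, complexify ρ M = ∑ a, (1 / 2 * (M * gellMann a).trace) • gellMannOp ρ a :=
    fun M => rfl
  have hcomm : M * N - N * M = ∑ a, ∑ b, ((1 / 2 * (M * gellMann a).trace) *
      (1 / 2 * (N * gellMann b).trace)) • (gellMann a * gellMann b - gellMann b * gellMann a) := by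
    set cM := fun a => 1 / 2 * (M * gellMann a).trace with hcM
    set cN := fun a => 1 / 2 * (N * gellMann a).trace with hcN
    have e : M * N - N * M = (∑ a, cM a • gellMann a) * (∑ b, cN b • gellMann b) -
        (∑ b, cN b • gellMann b) * (∑ a, cM a • gellMann a) := by
      rw [sum_trace_smul_gellMann, sum_trace_smul_gellMann]
      simp only [mul_sub, sub_mul, Matrix.smul_mul, Matrix.mul_smul, mul_one, one_mul,
        smul_smul]
      rw [mul_comm (N.trace / 3)]
      abel
    rw [e, Finset.sum_mul_sum, Finset.sum_mul_sum, Finset.sum_comm (s := Finset.univ)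
      (f := fun b a => cN b • gellMann b * cM a • gellMann a), ← Finset.sum_sub_distrib]
    refine Finset.sum_congr rfl fun a _ => ?_
    rw [← Finset.sum_sub_distrib]
    refine Finset.sum_congr rfl fun b _ => ?_
    simp only [Matrix.smul_mul, Matrix.mul_smul, smul_smul, smul_sub, mul_comm (cN b)]
    rfl
  rw [hcomm]
  simp only [map_sum, map_smul, hbasis]
  rw [hop M, hop N, Finset.sum_mul_sum, Finset.sum_mul_sum, Finset.sum_comm (s := Finset.univ)
    (f := fun b a => (1 / 2 * (N * gellMann b).trace) • gellMannOp ρ b *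
      (1 / 2 * (M * gellMann a).trace) • gellMannOp ρ a), ← Finset.sum_sub_distrib]
  refine Finset.sum_congr rfl fun a _ => ?_
  rw [← Finset.sum_sub_distrib]
  refine Finset.sum_congr rfl fun b _ => ?_
  rw [smul_mul_smul_comm, smul_mul_smul_comm, mul_comm (1 / 2 * (N * gellMann b).trace), smul_sub]

/-- The matrix units of `gl(3)` acting on a representation of `su(3)`. -/
noncomputable def matrixUnit (ρ : su3 →ₗ[ℝ] (V →L[ℂ] V)) (i j : Fin 3) : Module.End ℂ V :=
  complexify ρ (Matrix.single i j 1)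

theorem gl3Action_matrixUnit (ρ : su3 →ₗ[ℝ] (V →L[ℂ] V))
    (hρ : ∀ x y, ρ ⁅x, y⁆ = ρ x * ρ y - ρ y * ρ x) : GL3Action (matrixUnit ρ) where
  comm i j k l x := by
    have h := complexify_lie ρ hρ (Matrix.single i j 1) (Matrix.single k l 1)
    have h1 : Matrix.single i j (1 : ℂ) * Matrix.single k l 1 =
        if j = k then Matrix.single i l 1 else 0 := by
      split_ifs with hjk
      · subst hjk; simp
      · rw [Matrix.single_mul_single_of_ne _ _ _ _ hjk]
    have h2 : Matrix.single k l (1 : ℂ) * Matrix.single i j 1 =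
        if l = i then Matrix.single k j 1 else 0 := by
      split_ifs with hjk
      · subst hjk; simp
      · rw [Matrix.single_mul_single_of_ne _ _ _ _ hjk]
    rw [h1, h2, map_sub] at h
    have hx := LinearMap.congr_fun h x
    simp only [LinearMap.sub_apply, Module.End.mul_apply] at hx
    have e1 : complexify ρ (if j = k then Matrix.single i l 1 else 0) x =
        if j = k then matrixUnit ρ i l x else 0 := by
      split_ifs <;> simp [matrixUnit]
    have e2 : complexify ρ (if l = i then Matrix.single k j 1 else 0) x =
        if l = i then matrixUnit ρ k j x else 0 := by
      split_ifs <;> simp [matrixUnit]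
    rw [e1, e2] at hx
    rw [add_sub_assoc, hx]
    simp [matrixUnit]
  trace x := by
    have h : (1 : Matrix (Fin 3) (Fin 3) ℂ) =
        Matrix.single 0 0 1 + Matrix.single 1 1 1 + Matrix.single 2 2 1 := by
      ext i j; fin_cases i <;> fin_cases j <;> simp
    have h1 := complexify_one ρ
    rw [h, map_add, map_add] at h1
    exact LinearMap.congr_fun h1 x

theorem complexify_eq_sum (ρ : su3 →ₗ[ℝ] (V →L[ℂ] V)) (M : Matrix (Fin 3) (Fin 3) ℂ) :
    complexify ρ M = ∑ i, ∑ j, M i j • matrixUnit ρ i j := by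
  conv_lhs => rw [Matrix.matrix_eq_sum_single M]
  simp only [map_sum, matrixUnit, ← map_smul, Matrix.smul_single, smul_eq_mul, mul_one]

end Bridge

/-! ### Invariant subspaces of the group and of its Lie algebra -/

section Invariance

attribute [local instance 100] LieRing.ofAssociativeRing

open Filter Topology

variable {V : Type*} [NormedAddCommGroup V] [NormedSpace ℂ V]

theorem gellMannOp_eq (ρ : su3 →ₗ[ℝ] (V →L[ℂ] V)) (a : Fin 8) (v : V) :
    gellMannOp ρ a v = ∑ i, ∑ j, gellMann a i j • matrixUnit ρ i j v := by
  rw [← complexify_gellMann, complexify_eq_sum]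
  simp

variable [FiniteDimensional ℂ V]

/-- `ρ` is the derivative of the representation `π`. -/
def IsDerivedRep (π : Representation ℂ SU3 V) (ρ : su3 →ₗ[ℝ] (V →L[ℂ] V)) : Prop :=
  (∀ x, repCLM π (expSU3 x) = NormedSpace.exp (ρ x)) ∧ ∀ x y, ρ ⁅x, y⁆ = ρ x * ρ y - ρ y * ρ x

variable {π : Representation ℂ SU3 V} {ρ : su3 →ₗ[ℝ] (V →L[ℂ] V)}

namespace IsDerivedRep

theorem gl3 (D : IsDerivedRep π ρ) : GL3Action (matrixUnit ρ) := gl3Action_matrixUnit ρ D.2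

theorem hasDerivAt (D : IsDerivedRep π ρ) (x : su3) (v : V) :
    HasDerivAt (fun t : ℝ => π (expSU3 (t • x)) v) (ρ x v) 0 := by
  have : CompleteSpace V := FiniteDimensional.complete ℂ V
  have h := hasDerivAt_exp_smul_zero (ρ x)
  have h2 := ((ContinuousLinearMap.apply ℂ V v).restrictScalars ℝ).hasFDerivAt.comp_hasDerivAt
    (0 : ℝ) h
  refine h2.congr_of_eventuallyEq (Eventually.of_forall fun t => ?_)
  change repCLM π (expSU3 (t • x)) v = NormedSpace.exp (t • ρ x) v
  rw [D.1, map_smul]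

theorem dRep_eq (D : IsDerivedRep π ρ) (x : su3) (v : V) : dRep π x v = ρ x v :=
  (D.hasDerivAt x v).deriv

theorem opL_eq (D : IsDerivedRep π ρ) (a : Fin 8) (v : V) : opL π a v = gellMannOp ρ a v := by
  rw [opL, D.dRep_eq]; rfl

theorem trace_matrixUnit (D : IsDerivedRep π ρ) (v : V) :
    matrixUnit ρ 2 2 v = -(matrixUnit ρ 0 0 v + matrixUnit ρ 1 1 v) :=
  eq_neg_of_add_eq_zero_right (D.gl3.trace v)

theorem opL_zero (D : IsDerivedRep π ρ) (v : V) :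
    opL π 0 v = matrixUnit ρ 0 1 v + matrixUnit ρ 1 0 v := by
  rw [D.opL_eq, gellMannOp_eq]; simp [gellMann, Fin.sum_univ_three]

theorem opL_one (D : IsDerivedRep π ρ) (v : V) :
    opL π 1 v = (-Complex.I) • matrixUnit ρ 0 1 v + Complex.I • matrixUnit ρ 1 0 v := by
  rw [D.opL_eq, gellMannOp_eq]; simp [gellMann, Fin.sum_univ_three]

theorem opL_two (D : IsDerivedRep π ρ) (v : V) :
    opL π 2 v = (matrixUnit ρ 0 0 - matrixUnit ρ 1 1) v := by
  rw [D.opL_eq, gellMannOp_eq]; simp [gellMann, Fin.sum_univ_three, sub_eq_add_neg]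

theorem opL_three (D : IsDerivedRep π ρ) (v : V) :
    opL π 3 v = matrixUnit ρ 0 2 v + matrixUnit ρ 2 0 v := by
  rw [D.opL_eq, gellMannOp_eq]; simp [gellMann, Fin.sum_univ_three]

theorem opL_four (D : IsDerivedRep π ρ) (v : V) :
    opL π 4 v = (-Complex.I) • matrixUnit ρ 0 2 v + Complex.I • matrixUnit ρ 2 0 v := by
  rw [D.opL_eq, gellMannOp_eq]; simp [gellMann, Fin.sum_univ_three]

theorem opL_five (D : IsDerivedRep π ρ) (v : V) :
    opL π 5 v = matrixUnit ρ 1 2 v + matrixUnit ρ 2 1 v := by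
  rw [D.opL_eq, gellMannOp_eq]; simp [gellMann, Fin.sum_univ_three]

theorem opL_six (D : IsDerivedRep π ρ) (v : V) :
    opL π 6 v = (-Complex.I) • matrixUnit ρ 1 2 v + Complex.I • matrixUnit ρ 2 1 v := by
  rw [D.opL_eq, gellMannOp_eq]; simp [gellMann, Fin.sum_univ_three]

theorem sqrt_three_opL_seven (D : IsDerivedRep π ρ) (v : V) :
    ((Real.sqrt 3 : ℝ) : ℂ) • opL π 7 v = ((-3 : ℂ) • matrixUnit ρ 2 2) v := by
  rw [D.opL_eq, gellMannOp_eq]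
  simp only [gellMann, Fin.sum_univ_three]
  simp [smul_smul, D.trace_matrixUnit]
  module

theorem opL_raise (D : IsDerivedRep π ρ) (v : V) :
    opL π 0 v + Complex.I • opL π 1 v = (2 : ℂ) • matrixUnit ρ 0 1 v := by
  rw [D.opL_zero, D.opL_one, smul_add, smul_smul, smul_smul, mul_neg, Complex.I_mul_I]
  module

theorem opL_lower (D : IsDerivedRep π ρ) (v : V) :
    opL π 0 v - Complex.I • opL π 1 v = (2 : ℂ) • matrixUnit ρ 1 0 v := by
  rw [D.opL_zero, D.opL_one, smul_add, smul_smul, smul_smul, mul_neg, Complex.I_mul_I]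
  module

theorem opL_raise' (D : IsDerivedRep π ρ) (v : V) :
    opL π 5 v + Complex.I • opL π 6 v = (2 : ℂ) • matrixUnit ρ 1 2 v := by
  rw [D.opL_five, D.opL_six, smul_add, smul_smul, smul_smul, mul_neg, Complex.I_mul_I]
  module

/-- A subspace stable under a generator is stable under its exponential. -/
theorem exp_mem_of_stable (D : IsDerivedRep π ρ) (W : Submodule ℂ V) (x : su3)
    (hx : ∀ w ∈ W, ρ x w ∈ W) : ∀ w ∈ W, π (expSU3 x) w ∈ W := by
  have : CompleteSpace V := FiniteDimensional.complete ℂ V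
  -- The operators preserving `W` form a closed subalgebra, hence contain the exponentials of their
  -- elements.
  let S : Subalgebra ℂ (V →L[ℂ] V) :=
    { carrier := {A | ∀ w ∈ W, A w ∈ W}
      mul_mem' := fun {A B} hA hB w hw => hA _ (hB w hw)
      add_mem' := fun {A B} hA hB w hw => W.add_mem (hA w hw) (hB w hw)
      algebraMap_mem' := fun r w hw => by
        simpa [Algebra.algebraMap_eq_smul_one] using W.smul_mem r hw }
  have hclosed : IsClosed (S : Set (V →L[ℂ] V)) := by
    have h : (S : Set (V →L[ℂ] V)) = ⋂ w : W, {A | A w ∈ W} := by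
      ext A
      simp only [Set.mem_iInter, Subtype.forall]
      rfl
    rw [h]
    refine isClosed_iInter fun w => ?_
    exact (W.closed_of_finiteDimensional).preimage (ContinuousLinearMap.apply ℂ V (w : V)).continuous
  let _ : NormedAlgebra ℚ (V →L[ℂ] V) := NormedAlgebra.restrictScalars ℚ ℝ _
  have _ : IsScalarTower ℚ ℂ (V →L[ℂ] V) := ⟨fun q z A => by
    change (q • z) • A = (q : ℝ) • (z • A)
    rw [← smul_assoc, Rat.smul_def, Complex.real_smul, Complex.ofReal_ratCast]⟩
  have h := NormedSpace.exp_mem (R := ℂ) hclosed (x := ρ x) hx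
  rw [← D.1] at h
  exact h

/-- The difference quotients lie in `W`, which is closed because it is finite-dimensional. -/
theorem stable_of_exp_mem (D : IsDerivedRep π ρ) (W : Submodule ℂ V) (x : su3)
    (hx : ∀ t : ℝ, ∀ w ∈ W, π (expSU3 (t • x)) w ∈ W) : ∀ w ∈ W, ρ x w ∈ W := by
  intro w hw
  have h := hasDerivAt_iff_tendsto_slope_zero.1 (D.hasDerivAt x w)
  refine W.closed_of_finiteDimensional.mem_of_tendsto h (Eventually.of_forall fun t => ?_)
  exact (W.restrictScalars ℝ).smul_mem _ (W.sub_mem (hx _ w hw) (hx _ w hw))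

theorem apply_mem_of_stable (D : IsDerivedRep π ρ) (W : Submodule ℂ V)
    (hW : ∀ i j, ∀ w ∈ W, matrixUnit ρ i j w ∈ W) (g : SU3) : ∀ w ∈ W, π g w ∈ W := by
  have hx : ∀ x : su3, ∀ w ∈ W, ρ x w ∈ W := fun x w hw => by
    have h := LinearMap.congr_fun (complexify_su3 ρ x) w
    rw [complexify_eq_sum, LinearMap.sum_apply] at h
    rw [← ContinuousLinearMap.coe_coe, ← h]
    refine W.sum_mem fun i _ => ?_
    rw [LinearMap.sum_apply]
    exact W.sum_mem fun j _ => W.smul_mem _ (hW i j w hw)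
  obtain ⟨x, y, rfl, -⟩ := exists_expSU3_mul_expSU3 g
  intro w hw
  rw [map_mul, Module.End.mul_apply]
  exact D.exp_mem_of_stable W x (hx x) _ (D.exp_mem_of_stable W y (hx y) _ hw)

theorem eq_bot_or_top_of_stable (D : IsDerivedRep π ρ) (hirr : π.IsIrreducible) (W : Submodule ℂ V)
    (hW : ∀ i j, ∀ w ∈ W, matrixUnit ρ i j w ∈ W) : W = ⊥ ∨ W = ⊤ := by
  let S : Subrepresentation π := ⟨W, fun g w hw => D.apply_mem_of_stable W hW g w hw⟩
  rcases eq_bot_or_eq_top S with h | h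
  · exact Or.inl (congrArg Subrepresentation.toSubmodule h)
  · exact Or.inr (congrArg Subrepresentation.toSubmodule h)

theorem entries_of_commute {x : Matrix (Fin 3) (Fin 3) ℂ}
    (h : Commute (Matrix.single 2 2 (1 : ℂ)) x) :
    x 0 2 = 0 ∧ x 1 2 = 0 ∧ x 2 0 = 0 ∧ x 2 1 = 0 := by
  have hij := fun i j => congrFun (congrFun h.eq i) j
  have h1 := hij 0 2
  have h2 := hij 1 2
  have h3 := hij 2 0
  have h4 := hij 2 1
  simp [Matrix.mul_apply, Matrix.single_apply] at h1 h2 h3 h4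
  exact ⟨h1.symm, h2.symm, h3, h4⟩

theorem expSU3_mem_U2 {x : su3} (h : Commute (Matrix.single 2 2 (1 : ℂ)) x.1) :
    expSU3 x ∈ U2 :=
  entries_of_commute h.exp_right

theorem commute_iGellMann {a : Fin 8} (ha : a = 0 ∨ a = 1 ∨ a = 2 ∨ a = 7) :
    Commute (Matrix.single 2 2 (1 : ℂ)) (iGellMann a).1 := by
  have h : Commute (Matrix.single 2 2 (1 : ℂ)) (gellMann a) := by
    rcases ha with rfl | rfl | rfl | rfl <;> ext i j <;> fin_cases i <;> fin_cases j <;>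
      simp [gellMann, Matrix.mul_apply, Matrix.single_apply]
  exact h.smul_right _

/-- Invariance under the group `U2` and under its complexified Lie algebra are equivalent. -/
theorem invariant_iff (D : IsDerivedRep π ρ) (W : Submodule ℂ V) :
    (∀ g ∈ U2, ∀ w ∈ W, π g w ∈ W) ↔ ∀ w ∈ W, matrixUnit ρ 0 1 w ∈ W ∧ matrixUnit ρ 1 0 w ∈ W ∧
      (matrixUnit ρ 0 0 - matrixUnit ρ 1 1) w ∈ W ∧ ((-3 : ℂ) • matrixUnit ρ 2 2) w ∈ W := by
  constructor
  · intro hW w hw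
    have hL : ∀ a : Fin 8, (a = 0 ∨ a = 1 ∨ a = 2 ∨ a = 7) → opL π a w ∈ W := by
      intro a ha
      rw [opL, D.dRep_eq]
      refine W.smul_mem _ (D.stable_of_exp_mem W _ (fun t => hW _ (expSU3_mem_U2 ?_)) w hw)
      exact (commute_iGellMann ha).smul_right t
    refine ⟨?_, ?_, ?_, ?_⟩
    · have h : matrixUnit ρ 0 1 w = (1 / 2 : ℂ) • (opL π 0 w + Complex.I • opL π 1 w) := by
        rw [D.opL_raise]; module
      rw [h]
      exact W.smul_mem _ (W.add_mem (hL 0 (by simp)) (W.smul_mem _ (hL 1 (by simp))))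
    · have h : matrixUnit ρ 1 0 w = (1 / 2 : ℂ) • (opL π 0 w - Complex.I • opL π 1 w) := by
        rw [D.opL_lower]; module
      rw [h]
      exact W.smul_mem _ (W.sub_mem (hL 0 (by simp)) (W.smul_mem _ (hL 1 (by simp))))
    · rw [← D.opL_two]; exact hL 2 (by simp)
    · rw [← D.sqrt_three_opL_seven]; exact W.smul_mem _ (hL 7 (by simp))
  · intro hW g hg w hw
    -- With the trace relation, E₀₀ - E₁₁ and E₂₂ recover all three diagonal units, and these
    -- together with E₀₁ and E₁₀ span every block-diagonal generator.
    have h22 : ∀ w ∈ W, matrixUnit ρ 2 2 w ∈ W := fun w hw => by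
      have h := W.smul_mem (-1 / 3 : ℂ) (hW w hw).2.2.2
      have e : (-1 / 3 : ℂ) • ((-3 : ℂ) • matrixUnit ρ 2 2) w = matrixUnit ρ 2 2 w := by
        rw [LinearMap.smul_apply]; module
      rwa [e] at h
    have h00 : ∀ w ∈ W, matrixUnit ρ 0 0 w ∈ W := fun w hw => by
      have h := W.smul_mem (1 / 2 : ℂ) (W.sub_mem (hW w hw).2.2.1 (h22 w hw))
      have e : (1 / 2 : ℂ) • ((matrixUnit ρ 0 0 - matrixUnit ρ 1 1) w - matrixUnit ρ 2 2 w) =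
          matrixUnit ρ 0 0 w := by
        rw [D.trace_matrixUnit, LinearMap.sub_apply]; module
      rwa [e] at h
    have h11 : ∀ w ∈ W, matrixUnit ρ 1 1 w ∈ W := fun w hw => by
      have h := W.sub_mem (h00 w hw) (hW w hw).2.2.1
      rwa [LinearMap.sub_apply, sub_sub_cancel] at h
    have hx : ∀ x : su3, Commute (Matrix.single 2 2 (1 : ℂ)) x.1 → ∀ w ∈ W, ρ x w ∈ W := by
      intro x hc w hw
      obtain ⟨z1, z2, z3, z4⟩ := entries_of_commute hc
      have h := LinearMap.congr_fun (complexify_su3 ρ x) w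
      rw [complexify_eq_sum] at h
      rw [← ContinuousLinearMap.coe_coe, ← h]
      simp only [Fin.sum_univ_three, z1, z2, z3, z4,
        zero_smul, add_zero, zero_add]
      exact W.add_mem (W.add_mem (W.add_mem (W.smul_mem _ (h00 w hw)) (W.smul_mem _ (hW w hw).1))
        (W.add_mem (W.smul_mem _ (hW w hw).2.1) (W.smul_mem _ (h11 w hw))))
        (W.smul_mem _ (h22 w hw))
    obtain ⟨x, y, rfl, hxy⟩ := exists_expSU3_mul_expSU3 g
    obtain ⟨hxc, hyc⟩ := hxy hg
    rw [map_mul, Module.End.mul_apply]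
    exact D.exp_mem_of_stable W x (hx x hxc) _ (D.exp_mem_of_stable W y (hx y hyc) _ hw)

end IsDerivedRep

end Invariance

/-! ### Decomposition of an SU(3)-irrep under U(2) -/

section Branching

namespace GL2Action

variable {V : Type*} [AddCommGroup V] [Module ℂ V] {e f h c : Module.End ℂ V}

/-- Four times the Casimir operator of `sl(2)`. -/
def casimirOp (e f h : Module.End ℂ V) : Module.End ℂ V :=
  (4 : ℂ) • (f * e) + (2 : ℂ) • h + h * h

/-- Commutation with `f` is all that is needed, since a string is generated from its primitive
vector by `f`; there the value is 2n + n² = 4I(I + 1). -/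
theorem casimirOp_f (T : GL2Action e f h c) (x : V) :
    casimirOp e f h (f x) = f (casimirOp e f h x) := by
  simp only [casimirOp, LinearMap.add_apply, LinearMap.smul_apply, Module.End.mul_apply, T.ef,
    T.hf, map_add, map_sub, map_smul]
  module

theorem casimirOp_string (T : GL2Action e f h c) {n : ℕ} {q : ℤ} {w : V}
    (hw : w ∈ weightSpace h c n q) (h0 : e w = 0) {x : V} (hx : x ∈ string f n w) :
    casimirOp e f h x = (n * (n + 2) : ℂ) • x := by
  have hle : string f n w ≤ Module.End.eigenspace (casimirOp e f h) (n * (n + 2) : ℂ) := by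
    refine string_le (fun y hy => ?_) ?_
    · rw [Module.End.mem_eigenspace_iff] at hy ⊢
      rw [T.casimirOp_f, hy, map_smul]
    · rw [Module.End.mem_eigenspace_iff]
      have h1 := (mem_weightSpace.1 hw).1
      simp only [casimirOp, LinearMap.add_apply, LinearMap.smul_apply, Module.End.mul_apply, h0, h1,
        map_smul, map_zero]
      push_cast; module
  exact Module.End.mem_eigenspace_iff.1 (hle hx)

theorem c_string (T : GL2Action e f h c) {n : ℕ} {q : ℤ} {w : V}
    (hw : w ∈ weightSpace h c n q) {x : V} (hx : x ∈ string f n w) : c x = (q : ℂ) • x := by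
  have hle : string f n w ≤ Module.End.eigenspace c (q : ℂ) :=
    string_induction fun k _ => Module.End.mem_eigenspace_iff.2
      (mem_weightSpace.1 (T.f_pow_mem hw k)).2
  exact Module.End.mem_eigenspace_iff.1 (hle hx)

end GL2Action

variable {V : Type*} [NormedAddCommGroup V] [NormedSpace ℂ V]

/-- A highest weight vector of `gl(2)` with `2I = n`, `3Y = m`. -/
structure IsPrimitive (ρ : su3 →ₗ[ℝ] (V →L[ℂ] V)) (n : ℕ) (m : ℤ) (w : V) : Prop where
  weight : w ∈ weightSpace (matrixUnit ρ 0 0 - matrixUnit ρ 1 1) ((-3 : ℂ) • matrixUnit ρ 2 2) n m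
  raise : matrixUnit ρ 0 1 w = 0
  ne_zero : w ≠ 0

variable [FiniteDimensional ℂ V] {π : Representation ℂ SU3 V} {ρ : su3 →ₗ[ℝ] (V →L[ℂ] V)}

namespace IsDerivedRep

theorem isU2Irrep_string (D : IsDerivedRep π ρ) {n : ℕ} {m : ℤ} {w : V}
    (P : IsPrimitive ρ n m w) :
    IsU2Irrep π n m (GL2Action.string (matrixUnit ρ 1 0) n w) where
  invariant := (D.invariant_iff _).2 (D.gl3.gl2.string_stable P.weight P.raise)
  ne_bot := (Submodule.ne_bot_iff _).2 ⟨w, GL2Action.self_mem_string _ _ _, P.ne_zero⟩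
  minimal W hW hinv := by
    have hst := (D.invariant_iff W).1 hinv
    exact D.gl3.gl2.string_minimal P.weight P.raise P.ne_zero W hW (fun x hx => (hst x hx).1)
      fun x hx => (hst x hx).2.1
  weight := by
    refine ⟨w, GL2Action.self_mem_string _ _ _, P.ne_zero, ?_, ?_, ?_⟩
    · rw [D.opL_raise, P.raise, smul_zero]
    · rw [D.opL_two]; simpa using (mem_weightSpace.1 P.weight).1
    · rw [D.sqrt_three_opL_seven]; exact (mem_weightSpace.1 P.weight).2

/-- The string of the weight vector is a nonzero invariant subspace of `W`, so minimality makes it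
all of `W`. The classification of U(2)-irreps thereby reduces to primitive vectors. -/
theorem exists_isPrimitive (D : IsDerivedRep π ρ) {n : ℕ} {m : ℤ} {W : Submodule ℂ V}
    (hW : IsU2Irrep π n m W) :
    ∃ w, IsPrimitive ρ n m w ∧ W = GL2Action.string (matrixUnit ρ 1 0) n w := by
  obtain ⟨w, hwW, hne, h1, h2, h3⟩ := hW.weight
  have P : IsPrimitive ρ n m w := by
    refine ⟨mem_weightSpace.2 ⟨?_, ?_⟩, ?_, hne⟩
    · rw [← D.opL_two]; simpa using h2
    · rw [← D.sqrt_three_opL_seven]; exact h3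
    · rw [D.opL_raise] at h1
      exact (smul_eq_zero.1 h1).resolve_left two_ne_zero
  refine ⟨w, P, ?_⟩
  have hst := (D.invariant_iff W).1 hW.invariant
  have hle : GL2Action.string (matrixUnit ρ 1 0) n w ≤ W :=
    GL2Action.string_le (fun x hx => (hst x hx).2.1) hwW
  exact ((hW.minimal _ hle (D.isU2Irrep_string P).invariant).resolve_left
    (D.isU2Irrep_string P).ne_bot).symm

variable {o₁ o₂ : ℕ} {v : V}

/-- Branching from `SU(3)` to `U(2)` is multiplicity free. -/
theorem isU2Irrep_unique (D : IsDerivedRep π ρ)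
    (H : GL3Action.IsHighestWeight (matrixUnit ρ) o₁ o₂ v)
    (hspan : Submodule.span ℂ (Set.range (GL3Action.monomial (matrixUnit ρ) v)) = ⊤) {n : ℕ} {m : ℤ}
    {W₁ W₂ : Submodule ℂ V} (h₁ : IsU2Irrep π n m W₁) (h₂ : IsU2Irrep π n m W₂) : W₁ = W₂ := by
  obtain ⟨w₁, P₁, rfl⟩ := D.exists_isPrimitive h₁
  obtain ⟨w₂, P₂, rfl⟩ := D.exists_isPrimitive h₂
  obtain ⟨s, hs⟩ := D.gl3.exists_smul_of_primitive H hspan P₁.weight P₂.weight P₁.raise P₂.raise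
    P₂.ne_zero
  have hst := (D.invariant_iff _).1 h₂.invariant
  have hle : GL2Action.string (matrixUnit ρ 1 0) n w₁ ≤ GL2Action.string (matrixUnit ρ 1 0) n w₂ :=
    GL2Action.string_le (fun x hx => (hst x hx).2.1)
      (hs ▸ Submodule.smul_mem _ _ (GL2Action.self_mem_string _ _ _))
  exact (h₂.minimal _ hle h₁.invariant).resolve_left h₁.ne_bot

theorem u2Component_eq (D : IsDerivedRep π ρ)
    (H : GL3Action.IsHighestWeight (matrixUnit ρ) o₁ o₂ v)
    (hspan : Submodule.span ℂ (Set.range (GL3Action.monomial (matrixUnit ρ) v)) = ⊤) {n : ℕ} {m : ℤ}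
    {W : Submodule ℂ V} (hW : IsU2Irrep π n m W) : u2Component π n m = W :=
  le_antisymm (sSup_le fun _ hW' => (D.isU2Irrep_unique H hspan hW' hW).le) (le_sSup hW)

theorem isU2Irrep_u2Component (D : IsDerivedRep π ρ)
    (H : GL3Action.IsHighestWeight (matrixUnit ρ) o₁ o₂ v)
    (hspan : Submodule.span ℂ (Set.range (GL3Action.monomial (matrixUnit ρ) v)) = ⊤) {p : ℕ × ℤ}
    (hp : p ∈ branching π) : IsU2Irrep π p.1 p.2 (u2Component π p.1 p.2) := by
  obtain ⟨W, hW⟩ := hp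
  rwa [D.u2Component_eq H hspan hW]

theorem finrank_of_isU2Irrep (D : IsDerivedRep π ρ) {n : ℕ} {m : ℤ} {W : Submodule ℂ V}
    (hW : IsU2Irrep π n m W) : Module.finrank ℂ W = n + 1 := by
  obtain ⟨w, P, rfl⟩ := D.exists_isPrimitive hW
  exact D.gl3.gl2.finrank_string P.weight P.raise P.ne_zero

theorem casimirOp_of_mem (D : IsDerivedRep π ρ) {n : ℕ} {m : ℤ} {W : Submodule ℂ V}
    (hW : IsU2Irrep π n m W) {x : V} (hx : x ∈ W) :
    GL2Action.casimirOp (matrixUnit ρ 0 1) (matrixUnit ρ 1 0)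
      (matrixUnit ρ 0 0 - matrixUnit ρ 1 1) x = (n * (n + 2) : ℂ) • x := by
  obtain ⟨w, P, rfl⟩ := D.exists_isPrimitive hW
  exact D.gl3.gl2.casimirOp_string P.weight P.raise hx

theorem hypercharge_of_mem (D : IsDerivedRep π ρ) {n : ℕ} {m : ℤ} {W : Submodule ℂ V}
    (hW : IsU2Irrep π n m W) {x : V} (hx : x ∈ W) :
    ((-3 : ℂ) • matrixUnit ρ 2 2) x = (m : ℂ) • x := by
  obtain ⟨w, P, rfl⟩ := D.exists_isPrimitive hW
  exact D.gl3.gl2.c_string P.weight hx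

/-- The components lie in eigenspaces of one operator, with eigenvalues n(n + 2) + i m. These are
distinct because n ↦ n(n + 2) is injective on ℕ. -/
theorem iSupIndep_u2Component (D : IsDerivedRep π ρ) :
    iSupIndep fun p : ℕ × ℤ => u2Component π p.1 p.2 := by
  set K := GL2Action.casimirOp (matrixUnit ρ 0 1) (matrixUnit ρ 1 0)
      (matrixUnit ρ 0 0 - matrixUnit ρ 1 1) + Complex.I • ((-3 : ℂ) • matrixUnit ρ 2 2) with hK
  let d : ℕ × ℤ → ℂ := fun p => (p.1 * (p.1 + 2) : ℂ) + Complex.I * p.2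
  have hd : Function.Injective d := by
    rintro ⟨n, m⟩ ⟨n', m'⟩ h
    have hre := congrArg Complex.re h
    have him := congrArg Complex.im h
    simp [d] at hre him
    have hn : (n * (n + 2) : ℕ) = n' * (n' + 2) := by exact_mod_cast hre
    have : n = n' := by
      rcases lt_trichotomy n n' with hlt | heq | hgt
      · nlinarith
      · exact heq
      · nlinarith
    rw [this, him]
  refine ((Module.End.eigenspaces_iSupIndep K).comp hd).mono fun p => sSup_le fun W hW x hx => ?_
  rw [Function.comp_apply, Module.End.mem_eigenspace_iff, hK, LinearMap.add_apply,
    D.casimirOp_of_mem hW hx, LinearMap.smul_apply _ ((-3 : ℂ) • matrixUnit ρ 2 2),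
    D.hypercharge_of_mem hW hx, smul_smul, ← add_smul]

/-- The sum is stable under E₁₀ and contains every primitive vector, hence all weight vectors, and
these span `V`. -/
theorem iSup_u2Component (D : IsDerivedRep π ρ)
    (H : GL3Action.IsHighestWeight (matrixUnit ρ) o₁ o₂ v)
    (hspan : Submodule.span ℂ (Set.range (GL3Action.monomial (matrixUnit ρ) v)) = ⊤) :
    ⨆ p : ℕ × ℤ, u2Component π p.1 p.2 = ⊤ := by
  set P := ⨆ p : ℕ × ℤ, u2Component π p.1 p.2 with hP
  have hle : ∀ {n : ℕ} {m : ℤ} {W : Submodule ℂ V}, IsU2Irrep π n m W → W ≤ P :=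
    fun {n m W} hW => le_iSup_of_le (n, m) (le_sSup hW)
  have hf : ∀ x ∈ P, matrixUnit ρ 1 0 x ∈ P := by
    have : P ≤ P.comap (matrixUnit ρ 1 0) := iSup_le fun p => sSup_le fun W hW x hx =>
      hle hW ((D.invariant_iff W).1 hW.invariant x hx).2.1
    exact this
  rw [eq_top_iff, ← D.gl3.iSup_weightSpace H hspan]
  refine iSup_le fun j => iSup_le fun q => D.gl3.gl2.weightSpace_le P hf (fun n m x hx hex => ?_) j q
  by_cases hx0 : x = 0
  · rw [hx0]; exact P.zero_mem
  · exact hle (D.isU2Irrep_string ⟨hx, hex, hx0⟩) (GL2Action.self_mem_string _ _ _)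

theorem finite_branching (D : IsDerivedRep π ρ) : (branching π).Finite := by
  refine (WellFoundedGT.finite_ne_bot_of_iSupIndep D.iSupIndep_u2Component).subset ?_
  rintro p ⟨W, hW⟩ hbot
  exact hW.ne_bot (le_bot_iff.1 ((le_sSup hW).trans (le_of_eq hbot)))

theorem isInternal_u2Component (D : IsDerivedRep π ρ)
    (H : GL3Action.IsHighestWeight (matrixUnit ρ) o₁ o₂ v)
    (hspan : Submodule.span ℂ (Set.range (GL3Action.monomial (matrixUnit ρ) v)) = ⊤) :
    DirectSum.IsInternal fun p : ℕ × ℤ => u2Component π p.1 p.2 :=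
  DirectSum.isInternal_submodule_of_iSupIndep_of_iSup_eq_top D.iSupIndep_u2Component
    (D.iSup_u2Component H hspan)

theorem exists_isHighestWeight (D : IsDerivedRep π ρ) (hw : IsIrrepOfHighestWeight π o₁ o₂) :
    ∃ v, v ≠ 0 ∧ GL3Action.IsHighestWeight (matrixUnit ρ) o₁ o₂ v ∧
      Submodule.span ℂ (Set.range (GL3Action.monomial (matrixUnit ρ) v)) = ⊤ := by
  obtain ⟨hirr, v, hv, h1, h2, h3, h4⟩ := hw
  have H : GL3Action.IsHighestWeight (matrixUnit ρ) o₁ o₂ v := by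
    refine ⟨?_, ?_, ?_, ?_⟩
    · rw [D.opL_raise] at h1
      exact (smul_eq_zero.1 h1).resolve_left two_ne_zero
    · rw [D.opL_raise'] at h2
      exact (smul_eq_zero.1 h2).resolve_left two_ne_zero
    · rw [← h3, D.opL_two]; rfl
    · rw [← h4, D.opL_two, D.sqrt_three_opL_seven, LinearMap.smul_apply, LinearMap.sub_apply,
        D.trace_matrixUnit]
      module
  exact ⟨v, hv, H, D.gl3.span_monomial H hv (D.eq_bot_or_top_of_stable hirr)⟩

end IsDerivedRep

end Branching

/-! ### The Killing form of su(3) and the Laplacian of the metric -/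

section Metric

attribute [local instance 100] LieRing.ofAssociativeRing

theorem trace_smulRight_eq {K M : Type*} [Field K] [AddCommGroup M] [Module K M]
    [FiniteDimensional K M] (φ : M →ₗ[K] K) (w : M) :
    LinearMap.trace K M (φ.smulRight w) = φ w := by
  have h := LinearMap.trace_eq_contract_apply (R := K) (M := M) (TensorProduct.tmul K φ w)
  rw [contractLeft_apply] at h
  rw [← h]
  congr 1

/-- The contracted form of the completeness relation; it evaluates the trace of ad x ad y in the
Killing form. -/
theorem sum_gellMann_mul_mul (M : Matrix (Fin 3) (Fin 3) ℂ) :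
    ∑ a, gellMann a * M * gellMann a = (2 * M.trace) • 1 - (2 / 3 : ℂ) • M := by
  ext i j
  rw [Matrix.sum_apply, Fin.sum_univ_eight]
  simp only [Matrix.trace, Matrix.diag, Fin.sum_univ_three, Matrix.mul_apply]
  fin_cases i <;> fin_cases j <;> simp [gellMann] <;> ring_nf <;>
    simp only [Complex.I_sq, sqrt_three_inv_sq] <;> ring

theorem ofReal_gellMannCoord (z : su3) (a : Fin 8) :
    (gellMannCoord z a : ℂ) = -(1 / 2) * (z.1 * (iGellMann a).1).trace := by
  have h : z.1 = ∑ b, ((gellMannCoord z b : ℂ) * Complex.I) • gellMann b := by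
    conv_lhs => rw [← sum_gellMannCoord z, AddSubmonoidClass.coe_finsetSum]
    refine Finset.sum_congr rfl fun b _ => ?_
    rw [mul_smul]; rfl
  have hI : (iGellMann a).1 = Complex.I • gellMann a := rfl
  have h2 := fun b => half_trace_gellMann_mul a b
  have h3 : ∀ b, (gellMann b * gellMann a).trace = if a = b then 2 else 0 := fun b => by
    have := h2 b
    split_ifs at this ⊢ <;> linear_combination 2 * this
  rw [hI]
  conv_rhs => rw [h]
  simp only [Finset.sum_mul, Matrix.trace_sum, Matrix.smul_mul, Matrix.mul_smul, Matrix.trace_smul,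
    h3, smul_eq_mul, mul_ite, mul_zero, Finset.sum_ite_eq, Finset.mem_univ, if_true]
  linear_combination (gellMannCoord z a : ℂ) * Complex.I_mul_I

/-- The components in the basis `i λ_a` as linear forms. -/
noncomputable def gellMannForm (a : Fin 8) : su3 →ₗ[ℝ] ℝ where
  toFun z := gellMannCoord z a
  map_add' y z := by
    apply Complex.ofReal_injective
    rw [Complex.ofReal_add, ofReal_gellMannCoord, ofReal_gellMannCoord, ofReal_gellMannCoord]
    change -(1 / 2) * ((y.1 + z.1) * _).trace = _
    rw [add_mul, Matrix.trace_add, mul_add]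
  map_smul' c z := by
    apply Complex.ofReal_injective
    rw [RingHom.id_apply, smul_eq_mul, Complex.ofReal_mul, ofReal_gellMannCoord,
      ofReal_gellMannCoord]
    change -(1 / 2) * ((c • z.1) * _).trace = _
    rw [Matrix.smul_mul, Matrix.trace_smul, Complex.real_smul]
    ring

/-- The Killing form of `su(3)` is `6 tr(x y)`. -/
theorem killingForm_su3 (x y : su3) :
    ((killingForm ℝ su3 x y : ℝ) : ℂ) = 6 * (x.1 * y.1).trace := by
  have hop : ∀ F : su3 →ₗ[ℝ] su3,
      LinearMap.trace ℝ su3 F = ∑ a, gellMannCoord (F (iGellMann a)) a := by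
    intro F
    have hF : F = ∑ a, (gellMannForm a).smulRight (F (iGellMann a)) := by
      ext1 z
      conv_lhs => rw [← sum_gellMannCoord z, map_sum]
      rw [LinearMap.sum_apply]
      exact Finset.sum_congr rfl fun a _ => by rw [map_smul]; rfl
    conv_lhs => rw [hF]
    rw [map_sum]
    exact Finset.sum_congr rfl fun a _ => trace_smulRight_eq _ _
  rw [killingForm_apply_apply, hop, Complex.ofReal_sum]
  -- Expanding the double commutator and using cyclicity of the trace leaves only expressions λ M λ
  -- with M = 1 or M = y.
  have hterm : ∀ a, ((gellMannCoord (((LieAlgebra.ad ℝ su3 x) ∘ₗ (LieAlgebra.ad ℝ su3 y))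
      (iGellMann a)) a : ℝ) : ℂ) =
      (1 / 2) * (x.1 * y.1 * (gellMann a * 1 * gellMann a)).trace
        + (1 / 2) * (y.1 * x.1 * (gellMann a * 1 * gellMann a)).trace
        - (x.1 * (gellMann a * y.1 * gellMann a)).trace := by
    intro a
    rw [ofReal_gellMannCoord]
    have e : ((((LieAlgebra.ad ℝ su3 x) ∘ₗ (LieAlgebra.ad ℝ su3 y)) (iGellMann a) : su3).1 *
        (iGellMann a).1) = -((x.1 * (y.1 * gellMann a - gellMann a * y.1) -
          (y.1 * gellMann a - gellMann a * y.1) * x.1) * gellMann a) := by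
      change (x.1 * (y.1 * (Complex.I • gellMann a) - (Complex.I • gellMann a) * y.1) -
        (y.1 * (Complex.I • gellMann a) - (Complex.I • gellMann a) * y.1) * x.1) *
          (Complex.I • gellMann a) = _
      simp only [Matrix.mul_smul, Matrix.smul_mul, ← smul_sub, smul_smul, Complex.I_mul_I,
        neg_one_smul]
    have e2 : (x.1 * (y.1 * gellMann a - gellMann a * y.1) -
          (y.1 * gellMann a - gellMann a * y.1) * x.1) * gellMann a =
        x.1 * y.1 * (gellMann a * 1 * gellMann a) - x.1 * (gellMann a * y.1 * gellMann a)
        - y.1 * (gellMann a * x.1 * gellMann a) + gellMann a * (y.1 * x.1 * gellMann a) := by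
      rw [Matrix.mul_one]; noncomm_ring
    rw [e, e2, Matrix.trace_neg, Matrix.trace_add, Matrix.trace_sub, Matrix.trace_sub,
      Matrix.trace_mul_comm (gellMann a) (y.1 * x.1 * gellMann a),
      show y.1 * (gellMann a * x.1 * gellMann a) = (y.1 * gellMann a) * (x.1 * gellMann a) by
        noncomm_ring, Matrix.trace_mul_comm (y.1 * gellMann a),
      show x.1 * gellMann a * (y.1 * gellMann a) = x.1 * (gellMann a * y.1 * gellMann a) by
        noncomm_ring, show y.1 * x.1 * gellMann a * gellMann a =
        y.1 * x.1 * (gellMann a * 1 * gellMann a) by rw [Matrix.mul_one]; noncomm_ring]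
    ring
  have hy : y.1.trace = 0 := y.2.2
  simp only [hterm, Finset.sum_sub_distrib, Finset.sum_add_distrib, ← Finset.mul_sum,
    ← Matrix.trace_sum]
  -- For M = 1 the sum is 16/3, for the traceless y it is -(2/3) y; altogether 16/3 + 2/3 = 6.
  rw [sum_gellMann_mul_mul, sum_gellMann_mul_mul, hy, Matrix.trace_one]
  simp only [mul_sub, Matrix.mul_smul, Matrix.mul_one, Matrix.trace_sub, Matrix.trace_smul,
    smul_eq_mul, mul_zero, zero_mul, Matrix.trace_mul_comm y.1 x.1]
  norm_num
  ring

theorem killingInner_frame (a b : Fin 8) :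
    killingInner (frame a) (frame b) = if a = b then 1 else 0 := by
  apply Complex.ofReal_injective
  have h : killingInner (frame a) (frame b) = -killingForm ℝ su3 (frame a) (frame b) := rfl
  have h2 : ((frame a).1 * (frame b).1).trace = -(1 / 12) * (gellMann b * gellMann a).trace := by
    change ((1 / (2 * Real.sqrt 3) : ℝ) • (Complex.I • gellMann a) *
      (1 / (2 * Real.sqrt 3) : ℝ) • (Complex.I • gellMann b)).trace = _
    simp only [Matrix.smul_mul, Matrix.mul_smul, Matrix.trace_smul,
      Matrix.trace_mul_comm (gellMann a), Complex.real_smul, smul_eq_mul]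
    push_cast
    have := sqrt_three_inv_sq
    rw [one_div, mul_inv]
    linear_combination (1 / 4 * (gellMann b * gellMann a).trace) *
      ((((Real.sqrt 3 : ℝ) : ℂ)⁻¹) ^ 2 * Complex.I_mul_I - this)
  have h3 := half_trace_gellMann_mul a b
  rw [h, Complex.ofReal_neg, killingForm_su3, h2]
  rw [show -(6 * (-(1 / 12) * (gellMann b * gellMann a).trace)) =
    1 / 2 * (gellMann b * gellMann a).trace by ring, h3]
  split_ifs <;> simp

theorem killingInner_lie_self (x y : su3) : killingInner ⁅x, y⁆ y = 0 := by
  have h : killingInner ⁅x, y⁆ y = -killingForm ℝ su3 ⁅x, y⁆ y := rfl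
  rw [h, killingForm, LieModule.traceForm_apply_lie_apply, lie_self, map_zero, neg_zero]

variable {α β γ : ℝ}

theorem u2Metric_frame (x : su3) (a : Fin 8) :
    u2Metric α β γ x (frame a) = (dualComponents α β γ a)⁻¹ * killingInner (frame a) x := by
  simp only [u2Metric, LinearMap.sum_apply, LinearMap.smul_apply, LinearMap.smulRight_apply,
    killingInner_frame, smul_eq_mul, mul_ite, mul_one, mul_zero]
  rw [Finset.sum_eq_single a] <;> simp +contextual

theorem dualMetric_u2Metric (hα : α ≠ 0) (hβ : β ≠ 0) (hγ : γ ≠ 0) :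
    dualMetric (u2Metric α β γ) = Matrix.diagonal (dualComponents α β γ) := by
  have hd : ∀ a, dualComponents α β γ a ≠ 0 := by
    intro a; fin_cases a <;> simp [dualComponents, hα, hβ, hγ]
  have h : (Matrix.of fun a b => u2Metric α β γ (frame a) (frame b)) =
      Matrix.diagonal fun a => (dualComponents α β γ a)⁻¹ := by
    ext a b
    rw [Matrix.of_apply, u2Metric_frame, killingInner_frame, Matrix.diagonal_apply]
    by_cases hab : a = b
    · subst hab; simp
    · simp [hab, Ne.symm hab]
  rw [dualMetric, h]
  refine Matrix.inv_eq_right_inv ?_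
  rw [Matrix.diagonal_mul_diagonal, ← Matrix.diagonal_one]
  congr 1
  funext a
  exact inv_mul_cancel₀ (hd a)

theorem killingInner_comm (x y : su3) : killingInner x y = killingInner y x := by
  change -killingForm ℝ su3 x y = -killingForm ℝ su3 y x
  rw [killingForm, LieModule.traceForm_comm]

/-- In the Koszul formula the bracket [X_a, X_a] vanishes, and the other two terms are multiples of
k([X_d, X_a], X_a), which is 0 by invariance of k. This needs X_a to be an eigenvector of h relative
to k. -/
theorem christoffel_self (a c : Fin 8) :
    christoffel (u2Metric α β γ) a a c = 0 := by
  rw [christoffel]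
  refine Finset.sum_eq_zero fun d _ => ?_
  have h1 : ∀ x : su3, u2Metric α β γ ⁅x, frame a⁆ (frame a) = 0 := fun x => by
    rw [u2Metric_frame, killingInner_comm, killingInner_lie_self, mul_zero]
  have h2 : u2Metric α β γ ⁅frame a, frame d⁆ (frame a) = 0 := by
    rw [← lie_skew, map_neg, LinearMap.neg_apply, h1, neg_zero]
  rw [lie_self, map_zero, LinearMap.zero_apply, h1, h2]
  simp

theorem laplacian_u2Metric (hα : α ≠ 0) (hβ : β ≠ 0) (hγ : γ ≠ 0) (f : SU3 → ℂ) (g : SU3) :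
    laplacian (u2Metric α β γ) f g =
      ∑ a, (dualComponents α β γ a : ℂ) * leftField (frame a) (leftField (frame a) f) g := by
  rw [laplacian]
  refine Finset.sum_congr rfl fun a _ => ?_
  rw [Finset.sum_eq_single a]
  · simp [dualMetric_u2Metric hα hβ hγ, christoffel_self]
  · intro b _ hb
    simp [dualMetric_u2Metric hα hβ hγ, Matrix.diagonal_apply_ne _ hb.symm]
  · simp

theorem modifiedCasimir_u2Metric {V : Type*} [NormedAddCommGroup V] [NormedSpace ℂ V]
    (hα : α ≠ 0) (hβ : β ≠ 0) (hγ : γ ≠ 0) (π : Representation ℂ SU3 V) (v : V) :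
    modifiedCasimir (u2Metric α β γ) π v =
      -∑ a, (dualComponents α β γ a : ℂ) • dRep π (frame a) (dRep π (frame a) v) := by
  rw [modifiedCasimir]
  congr 1
  refine Finset.sum_congr rfl fun a _ => ?_
  rw [Finset.sum_eq_single a]
  · simp [dualMetric_u2Metric hα hβ hγ]
  · intro b _ hb
    simp [dualMetric_u2Metric hα hβ hγ, Matrix.diagonal_apply_ne _ hb.symm]
  · simp

end Metric

/-! ### The modified Casimir in terms of isospin and hypercharge -/

section CasimirFormula

variable {V : Type*} [NormedAddCommGroup V] [NormedSpace ℂ V]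

/-- The operator `-∑ dₐ X_a X_a`. -/
noncomputable def weightedCasimir (ρ : su3 →ₗ[ℝ] (V →L[ℂ] V)) (d : Fin 8 → ℝ) : Module.End ℂ V :=
  -∑ a, (d a : ℂ) • ((ρ (frame a) : V →ₗ[ℂ] V) * (ρ (frame a) : V →ₗ[ℂ] V))

theorem weightedCasimir_apply (ρ : su3 →ₗ[ℝ] (V →L[ℂ] V)) (d : Fin 8 → ℝ) (v : V) :
    weightedCasimir ρ d v = (1 / 12 : ℂ) • ∑ a, (d a : ℂ) • gellMannOp ρ a (gellMannOp ρ a v) := by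
  rw [weightedCasimir, LinearMap.neg_apply, LinearMap.sum_apply, Finset.smul_sum,
    ← Finset.sum_neg_distrib]
  refine Finset.sum_congr rfl fun a _ => ?_
  have hf : ∀ w, ρ (frame a) w = (((1 / (2 * Real.sqrt 3) : ℝ) : ℂ)) • ρ (iGellMann a) w := by
    intro w
    rw [frame, map_smul, Complex.coe_smul]; rfl
  have hg : ∀ w, gellMannOp ρ a w = (-Complex.I) • ρ (iGellMann a) w := fun w => rfl
  simp only [LinearMap.smul_apply, Module.End.mul_apply, ContinuousLinearMap.coe_coe, hf, hg,
    map_smul, smul_smul, ← neg_smul]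
  congr 1
  push_cast
  rw [one_div, mul_inv]
  linear_combination (-(d a : ℂ) / 4) * sqrt_three_inv_sq - (d a / 12 : ℂ) * Complex.I_mul_I

variable [FiniteDimensional ℂ V] {π : Representation ℂ SU3 V} {ρ : su3 →ₗ[ℝ] (V →L[ℂ] V)}

namespace IsDerivedRep

/-- The squares of all eight L_a add up to twice the gl(3) Casimir, those of L₁, L₂, L₃ to the sl(2)
Casimir 4I(I + 1), and L₈² = (3Y)²/3. Factoring out β leaves α - β and γ - β on the last two; the
factor 1/12 comes from the normalisation of X_a. -/
theorem weightedCasimir_dualComponents (D : IsDerivedRep π ρ) (α β γ : ℝ) (v : V) :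
    weightedCasimir ρ (dualComponents α β γ) v = (1 / 12 : ℂ) •
      ((2 * β : ℂ) • GL3Action.casimirOp (matrixUnit ρ) v + ((α : ℂ) - β) •
        GL2Action.casimirOp (matrixUnit ρ 0 1) (matrixUnit ρ 1 0)
          (matrixUnit ρ 0 0 - matrixUnit ρ 1 1) v +
        (((γ : ℂ) - β) / 3) • ((-3 : ℂ) • matrixUnit ρ 2 2) (((-3 : ℂ) • matrixUnit ρ 2 2) v)) := by
  rw [weightedCasimir_apply]
  congr 1
  have h0 : ∀ v, gellMannOp ρ 0 v = matrixUnit ρ 0 1 v + matrixUnit ρ 1 0 v := fun v => by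
    rw [← D.opL_eq, D.opL_zero]
  have h1 : ∀ v, gellMannOp ρ 1 v =
      (-Complex.I) • matrixUnit ρ 0 1 v + Complex.I • matrixUnit ρ 1 0 v := fun v => by
    rw [← D.opL_eq, D.opL_one]
  have h2 : ∀ v, gellMannOp ρ 2 v = matrixUnit ρ 0 0 v - matrixUnit ρ 1 1 v := fun v => by
    rw [← D.opL_eq, D.opL_two]; rfl
  have h3 : ∀ v, gellMannOp ρ 3 v = matrixUnit ρ 0 2 v + matrixUnit ρ 2 0 v := fun v => by
    rw [← D.opL_eq, D.opL_three]
  have h4 : ∀ v, gellMannOp ρ 4 v =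
      (-Complex.I) • matrixUnit ρ 0 2 v + Complex.I • matrixUnit ρ 2 0 v := fun v => by
    rw [← D.opL_eq, D.opL_four]
  have h5 : ∀ v, gellMannOp ρ 5 v = matrixUnit ρ 1 2 v + matrixUnit ρ 2 1 v := fun v => by
    rw [← D.opL_eq, D.opL_five]
  have h6 : ∀ v, gellMannOp ρ 6 v =
      (-Complex.I) • matrixUnit ρ 1 2 v + Complex.I • matrixUnit ρ 2 1 v := fun v => by
    rw [← D.opL_eq, D.opL_six]
  have h7 : ∀ v, gellMannOp ρ 7 v =
      (((Real.sqrt 3 : ℝ) : ℂ)⁻¹ * 3) • (matrixUnit ρ 0 0 v + matrixUnit ρ 1 1 v) := fun v => by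
    have h := D.sqrt_three_opL_seven v
    rw [D.opL_eq, LinearMap.smul_apply, D.trace_matrixUnit] at h
    rw [mul_smul, eq_inv_smul_iff₀ sqrt_three_ne_zero, h]
    module
  have h77 : gellMannOp ρ 7 (gellMannOp ρ 7 v) = (3 : ℂ) •
      (matrixUnit ρ 0 0 (matrixUnit ρ 0 0 v + matrixUnit ρ 1 1 v) +
        matrixUnit ρ 1 1 (matrixUnit ρ 0 0 v + matrixUnit ρ 1 1 v)) := by
    rw [h7 v, map_smul, h7, smul_smul]
    congr 1
    linear_combination 9 * sqrt_three_inv_sq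
  -- The squares E² and F² cancel against those of (E + F)², so each pair of Gell-Mann operators
  -- contributes 2(EF + FE).
  have hII : ∀ E F : Module.End ℂ V,
      (-Complex.I) • E ((-Complex.I) • E v + Complex.I • F v) +
        Complex.I • F ((-Complex.I) • E v + Complex.I • F v) =
      E (F v) + F (E v) - E (E v) - F (F v) := fun E F => by
    simp only [map_add, map_smul, smul_add, smul_smul, neg_mul, mul_neg, Complex.I_mul_I]
    module
  rw [Fin.sum_univ_eight, h77]
  simp only [h0, h1, h2, h3, h4, h5, h6, hII]
  simp only [dualComponents, GL3Action.casimirOp, GL2Action.casimirOp, Fin.sum_univ_three,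
    LinearMap.add_apply, LinearMap.smul_apply, Module.End.mul_apply, LinearMap.sub_apply,
    D.trace_matrixUnit, map_add, map_sub, map_neg, map_smul, D.gl3.gl2.ef]
  simp
  module

/-- The eigenspace through the highest weight vector is stable and nonzero, hence everything by
irreducibility. -/
theorem casimirOp_gl3 (D : IsDerivedRep π ρ) (hirr : π.IsIrreducible) {o₁ o₂ : ℕ} {w : V}
    (hw : w ≠ 0) (H : GL3Action.IsHighestWeight (matrixUnit ρ) o₁ o₂ w) (v : V) :
    GL3Action.casimirOp (matrixUnit ρ) v =
      (2 / 3 * ((o₁ : ℂ) ^ 2 + o₁ * o₂ + o₂ ^ 2) + 2 * (o₁ + o₂)) • v := by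
  have hE := D.eq_bot_or_top_of_stable hirr (Module.End.eigenspace
    (GL3Action.casimirOp (matrixUnit ρ)) (2 / 3 * ((o₁ : ℂ) ^ 2 + o₁ * o₂ + o₂ ^ 2) +
      2 * (o₁ + o₂))) fun i j x hx => by
    rw [Module.End.mem_eigenspace_iff] at hx ⊢
    rw [D.gl3.commute_casimirOp, hx, map_smul]
  have hwE := Module.End.mem_eigenspace_iff.2 (H.casimirOp_apply D.gl3)
  have htop := hE.resolve_left fun h => hw (by rwa [h, Submodule.mem_bot] at hwE)
  exact Module.End.mem_eigenspace_iff.1 (htop ▸ Submodule.mem_top)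

theorem casimir_eq (D : IsDerivedRep π ρ) (hirr : π.IsIrreducible) {o₁ o₂ : ℕ} {w : V}
    (hw : w ≠ 0) (H : GL3Action.IsHighestWeight (matrixUnit ρ) o₁ o₂ w) (v : V) :
    casimir π v = (casimirC2 o₁ o₂ : ℂ) • v := by
  have h : casimir π v = weightedCasimir ρ (dualComponents 1 1 1) v := by
    have hd : ∀ a, dualComponents 1 1 1 a = 1 := by intro a; fin_cases a <;> rfl
    simp [casimir, weightedCasimir, D.dRep_eq, hd]
  rw [h, D.weightedCasimir_dualComponents, D.casimirOp_gl3 hirr hw H, casimirC2]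
  push_cast
  module

theorem modifiedCasimir_eq (D : IsDerivedRep π ρ) {α β γ : ℝ} (hα : α ≠ 0) (hβ : β ≠ 0)
    (hγ : γ ≠ 0) (v : V) :
    modifiedCasimir (u2Metric α β γ) π v = weightedCasimir ρ (dualComponents α β γ) v := by
  rw [modifiedCasimir_u2Metric hα hβ hγ]
  simp [weightedCasimir, D.dRep_eq]

theorem weightedCasimir_of_mem (D : IsDerivedRep π ρ) (hirr : π.IsIrreducible) {o₁ o₂ : ℕ} {w : V}
    (hw : w ≠ 0) (H : GL3Action.IsHighestWeight (matrixUnit ρ) o₁ o₂ w) (α β γ : ℝ) {n : ℕ} {m : ℤ}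
    {W : Submodule ℂ V} (hW : IsU2Irrep π n m W) {v : V} (hv : v ∈ W) :
    weightedCasimir ρ (dualComponents α β γ) v =
      (laplaceEigenvalue α β γ o₁ o₂ (n / 2) (m / 3) : ℂ) • v := by
  rw [D.weightedCasimir_dualComponents, D.casimirOp_gl3 hirr hw H, D.casimirOp_of_mem hW hv,
    D.hypercharge_of_mem hW hv, map_smul, D.hypercharge_of_mem hW hv, laplaceEigenvalue, casimirC2]
  push_cast
  module

end IsDerivedRep

end CasimirFormula

/-! ### Burnside's theorem and matrix coefficients as traces -/

section MatrixCoefficients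

open Filter Topology

/-- **Burnside's theorem**: an irreducible finite-dimensional complex representation spans the
endomorphism algebra. -/
theorem span_range_eq_top_of_isIrreducible {G V : Type*} [Group G] [AddCommGroup V] [Module ℂ V]
    [FiniteDimensional ℂ V] (π : Representation ℂ G V) (hirr : π.IsIrreducible) :
    Submodule.span ℂ (Set.range π) = ⊤ := by
  classical
  let R : Subalgebra ℂ (Module.End ℂ V) := Algebra.adjoin ℂ (Set.range π)
  have hR : Subalgebra.toSubmodule R = Submodule.span ℂ (Set.range π) := by
    rw [Algebra.adjoin_eq_span, ← MonoidHom.coe_mrange, Submonoid.closure_eq]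
  have hπR : ∀ g, π g ∈ R := fun g => Algebra.subset_adjoin ⟨g, rfl⟩
  have hsub : ∀ N : Submodule ℂ V, (∀ g, ∀ v ∈ N, π g v ∈ N) → N = ⊥ ∨ N = ⊤ := by
    intro N hN
    let S : Subrepresentation π := ⟨N, fun g v hv => hN g v hv⟩
    rcases eq_bot_or_eq_top S with h | h
    · exact Or.inl (congrArg Subrepresentation.toSubmodule h)
    · exact Or.inr (congrArg Subrepresentation.toSubmodule h)
  have hnt : Nontrivial V := by
    by_contra h
    rw [not_nontrivial_iff_subsingleton] at h
    exact (bot_ne_top : (⊥ : Subrepresentation π) ≠ ⊤)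
      (Subrepresentation.toSubmodule_injective (Subsingleton.elim _ _))
  have hsimple : IsSimpleModule R V := by
    rw [isSimpleModule_iff]
    refine { eq_bot_or_eq_top := fun N => ?_ }
    rcases hsub (N.restrictScalars ℂ) (fun g v hv => N.smul_mem ⟨π g, hπR g⟩ hv) with h | h
    · exact Or.inl (by simpa using h)
    · exact Or.inr (by simpa using h)
  have hschur : ∀ e : Module.End R V, ∃ μ : ℂ, ∀ v, e v = μ • v := by
    intro e
    let e' : Module.End ℂ V := e.restrictScalars ℂ
    obtain ⟨μ, hμ⟩ := Module.End.exists_eigenvalue e'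
    refine ⟨μ, fun v => ?_⟩
    have hE := hsub (Module.End.eigenspace e' μ) fun g v hv => by
      rw [Module.End.mem_eigenspace_iff] at hv ⊢
      have h1 : e' (π g v) = π g (e' v) := e.map_smul ⟨π g, hπR g⟩ v
      rw [h1, hv, map_smul]
    have htop := hE.resolve_left (Module.End.hasEigenvalue_iff.1 hμ)
    exact Module.End.mem_eigenspace_iff.1 (htop ▸ Submodule.mem_top : v ∈ _)
  rw [← hR, eq_top_iff]
  intro T _
  -- By Schur the commutant consists of scalars, so every ℂ-linear map is linear over it; density
  -- then gives an element of `R` that agrees with `T` on a basis.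
  let T' : Module.End (Module.End R V) V :=
    { toFun := T
      map_add' := T.map_add
      map_smul' := fun e v => by
        obtain ⟨μ, hμ⟩ := hschur e
        simp only [RingHom.id_apply, Module.End.smul_def, hμ, map_smul] }
  let b := Module.finBasis ℂ V
  obtain ⟨r, hr⟩ := jacobson_density T' (Finset.univ.image b)
  have hTr : T = r.1 := b.ext fun i => hr (b i) (Finset.mem_image_of_mem _ (Finset.mem_univ i))
  rw [hTr]
  exact r.2

variable {V : Type*} [NormedAddCommGroup V] [NormedSpace ℂ V]

/-- The function `g ↦ tr(π(g) T)`. -/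
noncomputable def traceCoeff (π : Representation ℂ SU3 V) : Module.End ℂ V →ₗ[ℂ] (SU3 → ℂ) where
  toFun T g := LinearMap.trace ℂ V (π g * T)
  map_add' S T := by funext g; simp [mul_add]
  map_smul' c T := by funext g; simp

theorem traceCoeff_apply (π : Representation ℂ SU3 V) (T : Module.End ℂ V) (g : SU3) :
    traceCoeff π T g = LinearMap.trace ℂ V (π g * T) := rfl

variable [FiniteDimensional ℂ V] {π : Representation ℂ SU3 V}

theorem traceCoeff_smulRight (φ : Module.Dual ℂ V) (w : V) :
    traceCoeff π (φ.smulRight w) = fun g => φ (π g w) := by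
  funext g
  rw [traceCoeff_apply]
  have h : π g * φ.smulRight w = φ.smulRight (π g w) := by ext v; simp
  rw [h, trace_smulRight_eq]

/-- By Burnside the operators π(g) span all endomorphisms, and the trace pairing is nondegenerate,
as rank-one maps show. -/
theorem traceCoeff_injective (hirr : π.IsIrreducible) : Function.Injective (traceCoeff π) := by
  rw [injective_iff_map_eq_zero]
  intro T hT
  have hall : ∀ S : Module.End ℂ V, LinearMap.trace ℂ V (S * T) = 0 := by
    intro S
    have hS : S ∈ Submodule.span ℂ (Set.range π) := by
      rw [span_range_eq_top_of_isIrreducible π hirr]; trivial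
    induction hS using Submodule.span_induction with
    | mem S hS => obtain ⟨g, rfl⟩ := hS; exact congrFun hT g
    | zero => simp
    | add S S' _ _ h h' => rw [add_mul, map_add, h, h', add_zero]
    | smul c S _ h => rw [smul_mul_assoc, map_smul, h, smul_zero]
  ext v
  rw [LinearMap.zero_apply, ← Module.forall_dual_apply_eq_zero_iff ℂ]
  intro φ
  have h := hall (φ.smulRight v)
  have e : φ.smulRight v * T = (φ ∘ₗ T).smulRight v := by ext; simp
  rw [e, trace_smulRight_eq] at h
  exact h

/-- A coefficient φ(π(g) w) is the trace of π(g) against the rank-one map φ ⊗ w, and every map into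
`W` is a sum of such maps over a basis of `V`. This turns M(W) into a copy of Hom(V, W). -/
theorem mem_matrixCoeff_iff (W : Submodule ℂ V) (f : SU3 → ℂ) :
    f ∈ matrixCoeff π W ↔ ∃ T : Module.End ℂ V, (∀ v, T v ∈ W) ∧ f = traceCoeff π T := by
  constructor
  · intro hf
    let S : Submodule ℂ (Module.End ℂ V) :=
      { carrier := {T | ∀ v, T v ∈ W}
        add_mem' := fun hS hT v => W.add_mem (hS v) (hT v)
        zero_mem' := fun _ => W.zero_mem
        smul_mem' := fun c _ hT v => W.smul_mem c (hT v) }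
    have hle : matrixCoeff π W ≤ S.map (traceCoeff π) := by
      refine Submodule.span_le.2 ?_
      rintro _ ⟨φ, w, hw, rfl⟩
      exact ⟨φ.smulRight w, fun v => W.smul_mem _ hw, traceCoeff_smulRight φ w⟩
    obtain ⟨T, hT, rfl⟩ := hle hf
    exact ⟨T, hT, rfl⟩
  · rintro ⟨T, hT, rfl⟩
    let b := Module.finBasis ℂ V
    have h : T = ∑ i, (b.coord i).smulRight (T (b i)) := by
      refine b.ext fun j => ?_
      simp [Finsupp.single_apply, ite_smul]
    rw [h, map_sum]
    refine Submodule.sum_mem _ fun i _ => Submodule.subset_span ?_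
    exact ⟨b.coord i, T (b i), hT _, traceCoeff_smulRight _ _⟩

theorem finrank_matrixCoeff (hirr : π.IsIrreducible) (W : Submodule ℂ V) :
    Module.finrank ℂ (matrixCoeff π W) = Module.finrank ℂ V * Module.finrank ℂ W := by
  have h : matrixCoeff π W = LinearMap.range (traceCoeff π ∘ₗ
      (W.subtype.compRight ℂ : (V →ₗ[ℂ] W) →ₗ[ℂ] (V →ₗ[ℂ] V))) := by
    ext f
    rw [mem_matrixCoeff_iff, LinearMap.mem_range]
    constructor
    · rintro ⟨T, hT, rfl⟩
      exact ⟨T.codRestrict W hT, congrArg _ (LinearMap.ext fun v => rfl)⟩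
    · rintro ⟨T, rfl⟩
      exact ⟨W.subtype ∘ₗ T, fun v => (T v).2, rfl⟩
  rw [h, LinearMap.finrank_range_of_inj, Module.finrank_linearMap]
  refine (traceCoeff_injective hirr).comp fun S T hST => LinearMap.ext fun v => ?_
  exact Subtype.ext (LinearMap.congr_fun hST v)

variable {ρ : su3 →ₗ[ℝ] (V →L[ℂ] V)}

namespace IsDerivedRep

/-- `B ↦ tr(π(g) B T)` as a real continuous linear form. -/
theorem exists_traceForm (π : Representation ℂ SU3 V) (T : Module.End ℂ V) (g : SU3) :
    ∃ L : (V →L[ℂ] V) →L[ℝ] ℂ,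
      ∀ B : V →L[ℂ] V, L B = LinearMap.trace ℂ V (π g * ((B : V →ₗ[ℂ] V) * T)) := by
  let L₀ : (V →L[ℂ] V) →ₗ[ℂ] ℂ :=
    { toFun := fun B => LinearMap.trace ℂ V (π g * ((B : V →ₗ[ℂ] V) * T))
      map_add' := fun A B => by rw [ContinuousLinearMap.toLinearMap_add, add_mul, mul_add, map_add]
      map_smul' := fun c B => by
        rw [ContinuousLinearMap.toLinearMap_smul, smul_mul_assoc, mul_smul_comm, map_smul]; rfl }
  exact ⟨(LinearMap.toContinuousLinearMap L₀).restrictScalars ℝ, fun B => rfl⟩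

theorem traceCoeff_mul_exp (D : IsDerivedRep π ρ) (T : Module.End ℂ V) (g : SU3) (x : su3) :
    traceCoeff π T (g * expSU3 x) =
      LinearMap.trace ℂ V (π g * (((NormedSpace.exp (ρ x) : V →L[ℂ] V) : V →ₗ[ℂ] V) * T)) := by
  rw [traceCoeff_apply, map_mul π, ← D.1, mul_assoc]
  rfl

/-- Since π(g exp(tx)) = π(g) exp(tρ(x)), the derivative inserts ρ(x) between π(g) and `T`.
Differential operators thus become left multiplications on `T`. -/
theorem leftField_traceCoeff (D : IsDerivedRep π ρ) (T : Module.End ℂ V) (x : su3) :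
    leftField x (traceCoeff π T) = traceCoeff π ((ρ x : V →ₗ[ℂ] V) * T) := by
  have : CompleteSpace V := FiniteDimensional.complete ℂ V
  funext g
  obtain ⟨L, hL⟩ := exists_traceForm π T g
  have h := L.hasFDerivAt.comp_hasDerivAt (0 : ℝ) (hasDerivAt_exp_smul_zero (ρ x))
  rw [leftField, traceCoeff_apply, ← hL, ← h.deriv]
  congr 1
  funext t
  rw [D.traceCoeff_mul_exp, map_smul, Function.comp_apply, hL]

theorem isSmooth_traceCoeff (D : IsDerivedRep π ρ) (T : Module.End ℂ V) :
    IsSmooth (traceCoeff π T) := by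
  have : CompleteSpace V := FiniteDimensional.complete ℂ V
  intro g
  obtain ⟨L, hL⟩ := exists_traceForm π T g
  simp only [D.traceCoeff_mul_exp, ← hL, map_sum, map_smul]
  have hexp : ContDiff ℝ ∞ (NormedSpace.exp : (V →L[ℂ] V) → (V →L[ℂ] V)) :=
    contDiff_iff_contDiffAt.2 fun B => (NormedSpace.exp_analytic (𝕂 := ℝ) B).contDiffAt
  refine L.contDiff.comp (hexp.comp ?_)
  fun_prop

theorem laplacian_traceCoeff (D : IsDerivedRep π ρ) {α β γ : ℝ} (hα : α ≠ 0) (hβ : β ≠ 0)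
    (hγ : γ ≠ 0) (T : Module.End ℂ V) (g : SU3) :
    -laplacian (u2Metric α β γ) (traceCoeff π T) g =
      traceCoeff π (weightedCasimir ρ (dualComponents α β γ) * T) g := by
  rw [laplacian_u2Metric hα hβ hγ, weightedCasimir, neg_mul, map_neg, Pi.neg_apply, Finset.sum_mul,
    map_sum, Finset.sum_apply]
  congr 1
  refine Finset.sum_congr rfl fun a _ => ?_
  rw [D.leftField_traceCoeff, D.leftField_traceCoeff, smul_mul_assoc, map_smul, Pi.smul_apply,
    smul_eq_mul, mul_assoc]

/-- The eigenfunctions of the Laplacian among the matrix coefficients. -/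
theorem eigenfunction_iff (D : IsDerivedRep π ρ) (hirr : π.IsIrreducible) {α β γ : ℝ} (hα : α ≠ 0)
    (hβ : β ≠ 0) (hγ : γ ≠ 0) (x : ℂ) (f : SU3 → ℂ) :
    (f ∈ matrixCoeff π ⊤ ∧ ∀ g, -laplacian (u2Metric α β γ) f g = x * f g) ↔
      f ∈ matrixCoeff π (Module.End.eigenspace (weightedCasimir ρ (dualComponents α β γ)) x) := by
  have key : ∀ T : Module.End ℂ V, (∀ g, -laplacian (u2Metric α β γ) (traceCoeff π T) g =
      x * traceCoeff π T g) ↔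
      ∀ v, T v ∈ Module.End.eigenspace (weightedCasimir ρ (dualComponents α β γ)) x := by
    intro T
    have h1 : (∀ g, -laplacian (u2Metric α β γ) (traceCoeff π T) g = x * traceCoeff π T g) ↔
        traceCoeff π (weightedCasimir ρ (dualComponents α β γ) * T) = traceCoeff π (x • T) := by
      simp only [D.laplacian_traceCoeff hα hβ hγ, map_smul, funext_iff, Pi.smul_apply, smul_eq_mul]
    rw [h1, (traceCoeff_injective hirr).eq_iff, LinearMap.ext_iff]
    simp only [Module.End.mem_eigenspace_iff, Module.End.mul_apply, LinearMap.smul_apply]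
  rw [mem_matrixCoeff_iff, mem_matrixCoeff_iff]
  constructor
  · rintro ⟨⟨T, -, rfl⟩, h⟩
    exact ⟨T, (key T).1 h, rfl⟩
  · rintro ⟨T, hT, rfl⟩
    exact ⟨⟨T, fun _ => Submodule.mem_top, rfl⟩, (key T).2 hT⟩

end IsDerivedRep

end MatrixCoefficients

/-! ### Eigenspaces of an operator that is scalar on summands; the main theorem -/

section Multiplicity

variable {V : Type*} [AddCommGroup V] [Module ℂ V]

theorem finrank_sup_of_supIndep [FiniteDimensional ℂ V] {ι : Type*} (U : ι → Submodule ℂ V)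
    (s : Finset ι) (hs : s.SupIndep U) :
    Module.finrank ℂ (s.sup U : Submodule ℂ V) = ∑ i ∈ s, Module.finrank ℂ (U i) := by
  classical
  induction s using Finset.induction_on with
  | empty => simp
  | insert a s ha ih =>
    have hd : Disjoint (U a) (s.sup U) :=
      hs (Finset.subset_insert a s) (Finset.mem_insert_self a s) ha
    have h := Submodule.finrank_sup_add_finrank_inf_eq (U a) (s.sup U)
    rw [hd.eq_bot, finrank_bot, add_zero, ih (hs.subset (Finset.subset_insert a s))] at h
    rw [Finset.sup_insert, h, Finset.sum_insert ha]

/-- If `V` is the sum of subspaces on which `A` is scalar, the eigenspaces of `A` are the sums of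
those with the same scalar. -/
theorem eigenspace_eq_sup {ι : Type*} (U : ι → Submodule ℂ V) (A : Module.End ℂ V) (c : ι → ℂ)
    (hU : ∀ i, ∀ v ∈ U i, A v = c i • v) (htop : ⨆ i, U i = ⊤) (x : ℂ) (s : Finset ι)
    (hs : ∀ i, i ∈ s ↔ U i ≠ ⊥ ∧ c i = x) : Module.End.eigenspace A x = s.sup U := by
  apply le_antisymm
  · intro v hv
    let g : (Σ i, U i) → V := fun p => p.2.1
    have hspan : Submodule.span ℂ (Set.range g) = ⊤ := by
      rw [eq_top_iff, ← htop]
      exact iSup_le fun i w hw => Submodule.subset_span ⟨⟨i, w, hw⟩, rfl⟩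
    have h := mem_span_of_mem_eigenspace A g (fun p => c p.1) (fun p => hU p.1 _ p.2.2)
      (Module.End.mem_eigenspace_iff.1 hv) (hspan ▸ Submodule.mem_top)
    refine Submodule.span_le.2 ?_ h
    rintro _ ⟨⟨i, w, hw⟩, hi, rfl⟩
    by_cases hb : U i = ⊥
    · have : w = 0 := by rwa [hb, Submodule.mem_bot] at hw
      change w ∈ _
      rw [this]; exact Submodule.zero_mem _
    · exact (Finset.le_sup ((hs i).2 ⟨hb, hi⟩) : U i ≤ s.sup U) hw
  · refine Finset.sup_le fun i hi v hv => Module.End.mem_eigenspace_iff.2 ?_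
    rw [hU i v hv, ((hs i).1 hi).2]

end Multiplicity

theorem u2Component_ne_bot_iff {V : Type*} [NormedAddCommGroup V] [NormedSpace ℂ V]
    (π : Representation ℂ SU3 V) (p : ℕ × ℤ) :
    u2Component π p.1 p.2 ≠ ⊥ ↔ p ∈ branching π := by
  constructor
  · intro h
    by_contra hp
    refine h (sSup_eq_bot.2 fun W hW => (hp ⟨W, hW⟩).elim)
  · rintro ⟨W, hW⟩ h
    exact hW.ne_bot (le_bot_iff.1 (h ▸ le_sSup hW))

theorem mainTheorem8 (α β γ : ℝ) (hα : α ≠ 0) (hβ : β ≠ 0) (hγ : γ ≠ 0)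
    {V : Type*} [NormedAddCommGroup V] [NormedSpace ℂ V] [FiniteDimensional ℂ V]
    (π : Representation ℂ SU3 V) (hπ : ∀ v : V, Continuous fun g : SU3 => π g v)
    (o₁ o₂ : ℕ) (hw : IsIrrepOfHighestWeight π o₁ o₂) :
    -- the Casimir element of the Killing form acts by `C₂(o₁, o₂)`
    (∀ v : V, casimir π v = (casimirC2 o₁ o₂ : ℂ) • v) ∧
    -- `V` is the direct sum of its finitely many `U(2)`-components
    (branching π).Finite ∧
    DirectSum.IsInternal (fun p : ℕ × ℤ => u2Component π p.1 p.2) ∧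
    -- the component with `I = p.1 / 2`, `Y = p.2 / 3`: eigenvalue and multiplicity
    (∀ p ∈ branching π,
      IsU2Irrep π p.1 p.2 (u2Component π p.1 p.2) ∧
      Module.finrank ℂ (u2Component π p.1 p.2) = p.1 + 1 ∧
      (∀ v ∈ u2Component π p.1 p.2, modifiedCasimir (u2Metric α β γ) π v =
        (laplaceEigenvalue α β γ o₁ o₂ (p.1 / 2) (p.2 / 3) : ℂ) • v) ∧
      (∀ f ∈ matrixCoeff π (u2Component π p.1 p.2), IsSmooth f ∧
        ∀ g : SU3, -laplacian (u2Metric α β γ) f g =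
          (laplaceEigenvalue α β γ o₁ o₂ (p.1 / 2) (p.2 / 3) : ℂ) * f g) ∧
      Module.finrank ℂ (matrixCoeff π (u2Component π p.1 p.2)) =
        Module.finrank ℂ V * (p.1 + 1)) ∧
    -- the total multiplicity of `x` on the matrix coefficients of `V`: coinciding values add up
    (∀ x : ℂ,
      Module.finrank ℂ (Submodule.span ℂ
        {f : SU3 → ℂ | f ∈ matrixCoeff π ⊤ ∧
          ∀ g : SU3, -laplacian (u2Metric α β γ) f g = x * f g}) =
        ∑ᶠ p ∈ {p ∈ branching π |
            (laplaceEigenvalue α β γ o₁ o₂ (p.1 / 2) (p.2 / 3) : ℂ) = x},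
          Module.finrank ℂ V * (p.1 + 1)) := by
  obtain ⟨ρ, hρ⟩ := exists_derivedRep π hπ
  have D : IsDerivedRep π ρ := hρ
  have hirr : π.IsIrreducible := hw.1
  obtain ⟨v, hv, H, hspan⟩ := D.exists_isHighestWeight hw
  have hirrep : ∀ p ∈ branching π, IsU2Irrep π p.1 p.2 (u2Component π p.1 p.2) := fun p hp =>
    D.isU2Irrep_u2Component H hspan hp
  -- Stated for all pairs so that it applies to the full direct sum; off the branching set the
  -- component is zero.
  have hscalar : ∀ p : ℕ × ℤ, ∀ w ∈ u2Component π p.1 p.2,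
      weightedCasimir ρ (dualComponents α β γ) w =
        (laplaceEigenvalue α β γ o₁ o₂ (p.1 / 2) (p.2 / 3) : ℂ) • w := by
    intro p w hwp
    by_cases hp : p ∈ branching π
    · exact D.weightedCasimir_of_mem hirr hv H α β γ (hirrep p hp) hwp
    · rw [not_ne_iff.1 (mt (u2Component_ne_bot_iff π p).1 hp), Submodule.mem_bot] at hwp
      rw [hwp, map_zero, smul_zero]
  refine ⟨D.casimir_eq hirr hv H, D.finite_branching, D.isInternal_u2Component H hspan,
    fun p hp => ⟨hirrep p hp, D.finrank_of_isU2Irrep (hirrep p hp), ?_, ?_, ?_⟩, ?_⟩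
  · intro w hwp
    rw [D.modifiedCasimir_eq hα hβ hγ, hscalar p w hwp]
  · intro f hf
    obtain ⟨T, hT, rfl⟩ := (mem_matrixCoeff_iff _ _).1 hf
    refine ⟨D.isSmooth_traceCoeff T, fun g => ?_⟩
    rw [D.laplacian_traceCoeff hα hβ hγ]
    have h : weightedCasimir ρ (dualComponents α β γ) * T =
        (laplaceEigenvalue α β γ o₁ o₂ (p.1 / 2) (p.2 / 3) : ℂ) • T :=
      LinearMap.ext fun w => hscalar p _ (hT w)
    rw [h, map_smul]
    rfl
  · rw [finrank_matrixCoeff hirr, D.finrank_of_isU2Irrep (hirrep p hp)]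
  · intro x
    -- The eigenfunctions for `x` are exactly the matrix coefficients of the Casimir eigenspace for
    -- `x`, which is the sum of the components whose scalar is `x`. Coinciding values therefore add
    -- their dimensions.
    have hset : {f : SU3 → ℂ | f ∈ matrixCoeff π ⊤ ∧
        ∀ g : SU3, -laplacian (u2Metric α β γ) f g = x * f g} = (matrixCoeff π
          (Module.End.eigenspace (weightedCasimir ρ (dualComponents α β γ)) x) : Set (SU3 → ℂ)) :=
      Set.ext fun f => D.eigenfunction_iff hirr hα hβ hγ x f
    have hfin : {p ∈ branching π |
        (laplaceEigenvalue α β γ o₁ o₂ (p.1 / 2) (p.2 / 3) : ℂ) = x}.Finite :=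
      D.finite_branching.subset fun p hp => hp.1
    have hE := eigenspace_eq_sup (fun p : ℕ × ℤ => u2Component π p.1 p.2)
      (weightedCasimir ρ (dualComponents α β γ)) _ hscalar (D.iSup_u2Component H hspan) x
      hfin.toFinset fun p => by
        rw [hfin.mem_toFinset, u2Component_ne_bot_iff]; rfl
    rw [hset, Submodule.span_eq, finrank_matrixCoeff hirr, hE,
      finrank_sup_of_supIndep _ _ (D.iSupIndep_u2Component.supIndep' _),
      finsum_mem_eq_finite_toFinset_sum _ hfin, Finset.mul_sum]
    refine Finset.sum_congr rfl fun p hp => ?_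
    rw [D.finrank_of_isU2Irrep (hirrep p (hfin.mem_toFinset.1 hp).1)]
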